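/- **Data.** Let $\mathfrak h$ be a finite-dimensional complex vector space with a non-degenerate symmetric bilinear form $(\cdot,\cdot)$, let $\alpha_1,\dots,\alpha_R\in\mathfrak h^*$ be linearly independent (simple roots), and let $H_i\in\mathfrak h$ be the element with $x(H_i)=(\alpha_i,x)$ for all $x\in\mathfrak h^*$. Let $\sigma$ be a diagram automorphism: a permutation $\sigma$ of $\{1,\dots,R\}$, of order $T$, with a linear automorphism $\sigma$ of $\mathfrak h$ such that $\sigma(H_i)=H_{\sigma(i)}$ and $\alpha_{\sigma(i)}\circ\sigma=\alpha_i$. Let $\sigma$ act on $\mathfrak h^*$ by $(\sigma x)(\sigma h)=x(h)$, let $\mathfrak h^\sigma$ be the space of invariants, and for $\Lambda_0\in(\mathfrak h^\sigma)^*$ put $(\alpha_i,\Lambda_0):=\Lambda_0\big(\tfrac1T\sum_{k=0}^{T-1}\sigma^kH_i\big)$. Let $\iota(1),\dots,\iota(r)$ be representatives of the cycles of $\sigma$ (fixed points included), and $T_i$ the length of the cycle of $\iota(i)$. Let $\omega$ be a primitive $T$-th root of unity, let $z_1,\dots,z_N\in\mathbb C\setminus\{0\}$ satisfy $z_v\neq\omega^kz_w$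 for all $v\ne w$ and all $k$, and let $\Lambda_0\in(\mathfrak h^\sigma)^*$, $\Lambda_1,\dots,\Lambda_N\in\mathfrak h^*$. Let $\lambda=(\lambda_1,\dots,\lambda_r)\in\mathbb Z_{\ge0}^r$, $m=\lambda_1+\dots+\lambda_r$, and label the coordinates on $\mathbb C^m$ by $(i,n)=\lambda_1+\dots+\lambda_{i-1}+n$, $1\le i\le r$, $1\le n\le\lambda_i$. **Arrangement and weights.** Let $\mathcal C=\mathcal C_{0,N;m}$ be the arrangement in $\mathbb C^m$ of the hyperplanes $t_x=\omega^kt_y$ ($x\neq y$), $t_x=\omega^kz_v$ and $t_x=0$, where $k\in\mathbb Z/T$, with weights $$a\big(t_{(i,n)}=\omega^kt_{(j,p)}\big)=(\alpha_{\iota(i)},\sigma^k\alpha_{\iota(j)}),\quad a\big(t_{(i,n)}=\omega^kz_v\big)=-(\alpha_{\iota(i)},\sigma^k\Lambda_v),\quad a\big(t_{(i,n)}=0\big)=-(\alpha_{\iota(i)},\Lambda_0).$$ **Flags.** An edge of $\mathcal C$ is a non-empty intersection of hyperplanes of $\mathcal C$ (the whole space included). The flag space $\mathcal F^m$ is the complex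 vector space spanned by the flags $L^0\supset L^1\supset\dots\supset L^m$, with $L^j$ an edge of codimension $j$, modulo the relations saying that, for each $0<j<m$ and each fixed choice of all the $L^i$ with $i\ne j$, the sum of the flags over all possible $L^j$ is zero. For $H_1,\dots,H_m\in\mathcal C$ in general position with non-empty intersection, $F(H_1,\dots,H_m)\in\mathcal F^m$ is the flag with $L^j=H_1\cap\dots\cap H_j$. For any $H_1,\dots,H_m$, $\langle F,H_1\wedge\dots\wedge H_m\rangle$ is $(-1)^{|s|}$ if $F=F(H_{s(1)},\dots,H_{s(m)})$ for a permutation $s$, and $0$ otherwise; this is well defined on $\mathcal F^m$. Define $$\mathcal G:\mathcal F^m\to(\mathcal F^m)^*,\qquad \mathcal G(F)(F')=\sum_{\{H_1,\dots,H_m\}\subset\mathcal C}a(H_1)\cdots a(H_m)\,\langle F,H_1\wedge\dots\wedge H_m\rangle\,\langle F',H_1\wedge\dots\wedge H_m\rangle .$$ **Weight function.** Let $l_H$ be the equation of $H$ (e.g. $t_x-\omega^kt_y$, $t_x-\omega^kz_v$, $t_x$), and let $u_{H_1,\dots,H_m}$ be the rational function with $d\log l_{H_1}\wedge\dots\wedge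 d\log l_{H_m}=u_{H_1,\dots,H_m}\,dt_1\wedge\dots\wedge dt_m$. Let $\theta:\mathbb C^m\to\mathcal F^m$ be the rational map $$\theta=\sum u_{H_m,H_{m-1},\dots,H_1}\,F(H_m,H_{m-1},\dots,H_1),$$ summed over all choices, for each $x\in\{1,\dots,m\}$, of a hyperplane $H_x$ among $t_x=0$, $t_x=\omega^kz_v$ and $t_y=\omega^kt_x$ with $y<x$ (so that $\theta\,dt_1\wedge\dots\wedge dt_m$ is the canonical element of $\mathcal F^m\otimes(\mathcal F^m)^*$, if $(\mathcal F^m)^*$ is identified with the space of forms spanned by the $d\log l_{H_1}\wedge\dots\wedge d\log l_{H_m}$). Let $\Sigma\mathbb Z_\lambda=\prod_{i=1}^r\big(\Sigma_{\lambda_i}\ltimes(\mathbb Z/(T/T_i))^{\lambda_i}\big)$ act on $\mathbb C^m$ so that, for $g=(s,\mathbf k)$, the point $g^{-1}\cdot p$ has coordinates $t_{(i,n)}(g^{-1}\cdot p)=\omega^{T_ik_{i,n}}t_{(i,s_i(n))}(p)$; let $\chi(g)=\prod_{i,n}\omega^{T_ik_{i,n}}$, and put $$\theta^{\Sigma\mathbb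 Z_\lambda}(p)=\frac1{|\Sigma\mathbb Z_\lambda|}\sum_{g\in\Sigma\mathbb Z_\lambda}\chi(g)\,\theta(g^{-1}\cdot p).$$ The *cyclotomic weight function* is the rational map $\Psi=\mathcal G\circ\theta^{\Sigma\mathbb Z_\lambda}$ from $\mathbb C^m$ to $(\mathcal F^m)^*$. (It takes values in $\mathcal G\big((\mathcal F^m)^{\Sigma\mathbb Z_\lambda}\big)\cong L(\boldsymbol\Lambda)_\lambda$.) Say that $\Psi$ is regular at a point if it is a quotient of polynomials (the numerator vector-valued) whose denominator does not vanish there, and that it is regular on a hyperplane $H\in\mathcal C$ if it is regular at every point of $H$ that lies on no other hyperplane of $\mathcal C$. **Proposition.** 1. If $(\alpha_{\iota(i)},\sigma^k\alpha_{\iota(j)})=0$, then $\Psi$ is regular on the hyperplanes $t_{(i,n)}=\omega^kt_{(j,p)}$ for all $1\le n\le\lambda_i$, $1\le p\le\lambda_j$ with $(i,n)\neq(j,p)$. 2. If $(\alpha_{\iota(i)},\sigma^k\Lambda_v)=0$, where $1\le v\le N$, then $\Psi$ is regular on the hyperplanes $t_{(i,n)}=\omega^kz_v$, $1\le n\le\lambda_i$.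 If $(\alpha_{\iota(i)},\Lambda_0)=0$, then $\Psi$ is regular on the hyperplanes $t_{(i,n)}=0$, $1\le n\le\lambda_i$. Moreover, $\Psi$ is regular at every point of $\mathbb C^m$ that lies on no hyperplane of $\mathcal C$ of nonzero weight. -/

import Mathlib

/-! ## Affine hyperplane arrangements in `ℂ^m`, flags, and the geometric form -/

/-- A polynomial of degree at most one on `ℂ^m`, namely `t ↦ ∑ i, coeff i * t i - const`. -/
structure AffForm (m : ℕ) where
  coeff : Fin m → ℂ
  const : ℂ

namespace AffForm

variable {m : ℕ}

/-- The value of the affine form at a point. -/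
def eval (l : AffForm m) (t : Fin m → ℂ) : ℂ := ∑ i, l.coeff i * t i - l.const

/-- The linear part of the affine form. -/
def lin (l : AffForm m) : (Fin m → ℂ) →ₗ[ℂ] ℂ where
  toFun t := ∑ i, l.coeff i * t i
  map_add' s t := by simp [mul_add, Finset.sum_add_distrib]
  map_smul' c t := by
    simp only [Pi.smul_apply, smul_eq_mul, RingHom.id_apply, Finset.mul_sum]
    exact Finset.sum_congr rfl fun i _ => by ring

lemma eval_eq (l : AffForm m) (t : Fin m → ℂ) : l.eval t = l.lin t - l.const := rfl

/-- The zero locus of the affine form, an affine hyperplane if `coeff ≠ 0`. -/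
def hyperplane (l : AffForm m) : AffineSubspace ℂ (Fin m → ℂ) where
  carrier := {t | l.eval t = 0}
  smul_vsub_vadd_mem' := by
    intro c p q r hp hq hr
    simp only [Set.mem_ofPred_eq, eval_eq, vsub_eq_sub, vadd_eq_add, map_add, map_smul, map_sub,
      smul_eq_mul, sub_eq_zero] at *
    rw [hp, hq, hr]; ring

lemma mem_hyperplane (l : AffForm m) (t : Fin m → ℂ) : t ∈ l.hyperplane ↔ l.eval t = 0 := Iff.rfl

end AffForm

namespace Arrangement

variable {m : ℕ} {ι : Type*}

/-- The complement in `ℂ^m` of all the hyperplanes of the arrangement `(l_x = 0)_{x : ι}`. -/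
def complement (l : ι → AffForm m) : Set (Fin m → ℂ) := {t | ∀ x, t ∉ (l x).hyperplane}

/-- The codimension of (a non-empty affine subspace) `L` is `k`. -/
def HasCodim (L : AffineSubspace ℂ (Fin m → ℂ)) (k : ℕ) : Prop :=
  Module.finrank ℂ L.direction + k = m

/-- An edge is a non-empty intersection of hyperplanes of the arrangement
(the whole space, being the empty intersection, is an edge). -/
def IsEdge (l : ι → AffForm m) (L : AffineSubspace ℂ (Fin m → ℂ)) : Prop :=
  (L : Set (Fin m → ℂ)).Nonempty ∧ ∃ S : Set ι, L = ⨅ x ∈ S, (l x).hyperplane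

/-- `L^0 ⊇ L^1 ⊇ ⋯ ⊇ L^k` with each `L^j` an edge of codimension `j`. -/
structure IsFlag (l : ι → AffForm m) {k : ℕ} (L : Fin (k + 1) → AffineSubspace ℂ (Fin m → ℂ)) :
    Prop where
  antitone : Antitone L
  isEdge : ∀ j, IsEdge l (L j)
  codim : ∀ j, HasCodim (L j) j

/-- The set of flags of length `k`. -/
abbrev Flag (l : ι → AffForm m) (k : ℕ) : Type :=
  {L : Fin (k + 1) → AffineSubspace ℂ (Fin m → ℂ) // IsFlag l L}

instance [Finite ι] (l : ι → AffForm m) (k : ℕ) : Finite (Flag l k) := by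
  have h : Finite {L : AffineSubspace ℂ (Fin m → ℂ) // IsEdge l L} := by
    refine Set.Finite.subset (Set.finite_range
      (fun S : Set ι => (⨅ x ∈ S, (l x).hyperplane : AffineSubspace ℂ (Fin m → ℂ)))) ?_
    rintro L ⟨-, S, rfl⟩
    exact ⟨S, rfl⟩
  refine Finite.of_injective (β := Fin (k + 1) → {L // IsEdge l L})
    (fun F j => ⟨F.1 j, F.2.isEdge j⟩) ?_
  intro F F' hFF
  apply Subtype.ext
  funext j
  exact congrArg Subtype.val (congrFun hFF j)

noncomputable instance [Finite ι] (l : ι → AffForm m) (k : ℕ) : Fintype (Flag l k) :=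
  Fintype.ofFinite _

open Classical in
/-- The left-hand side of the flag relation obtained from `F` by forgetting its `i`-th edge:
the sum of all the flags that agree with `F` except possibly at the place `i`. -/
noncomputable def flagRelation [Finite ι] (l : ι → AffForm m) {k : ℕ} (F : Flag l k)
    (i : Fin (k + 1)) : Flag l k →₀ ℂ :=
  ∑ F' : Flag l k, if ∀ j, j ≠ i → F'.1 j = F.1 j then Finsupp.single F' 1 else 0

/-- The span of the flag relations, one for each flag with a gap at a place `0 < i < k`. -/
noncomputable def flagRelations [Finite ι] (l : ι → AffForm m) (k : ℕ) :
    Submodule ℂ (Flag l k →₀ ℂ) :=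
  Submodule.span ℂ {v | ∃ (F : Flag l k) (i : Fin (k + 1)), 0 < (i : ℕ) ∧ (i : ℕ) < k ∧
    v = flagRelation l F i}

/-- The (complex) flag space `𝓕^k` of the arrangement. -/
abbrev FlagSpace [Finite ι] (l : ι → AffForm m) (k : ℕ) : Type :=
  (Flag l k →₀ ℂ) ⧸ flagRelations l k

/-- The sequence `ℂ^m ⊇ H_1 ⊇ H_1 ∩ H_2 ⊇ ⋯ ⊇ H_1 ∩ ⋯ ∩ H_k` of a tuple of hyperplanes. -/
def chain (l : ι → AffForm m) {k : ℕ} (H : Fin k → ι) (i : Fin (k + 1)) :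
    AffineSubspace ℂ (Fin m → ℂ) :=
  ⨅ j : Fin k, ⨅ _ : (j : ℕ) < (i : ℕ), (l (H j)).hyperplane

open Classical in
/-- The class in the flag space of the flag `F(H_1, …, H_k)` of a tuple of hyperplanes in general
position (and zero if the hyperplanes are not in general position). -/
noncomputable def flagOf [Finite ι] (l : ι → AffForm m) {k : ℕ} (H : Fin k → ι) :
    FlagSpace l k :=
  if h : IsFlag l (chain l H) then
    (flagRelations l k).mkQ (Finsupp.single ⟨chain l H, h⟩ 1) else 0

open Classical in
/-- The pairing `⟨F, H_1 ∧ ⋯ ∧ H_k⟩` of a flag with a tuple of hyperplanes: it is the sign of the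
permutation `s` with `L^i = H_{s(1)} ∩ ⋯ ∩ H_{s(i)}` for all `i` if there is such an `s`
(which is then unique), and zero otherwise. -/
noncomputable def flagPairing (l : ι → AffForm m) {k : ℕ} (H : Fin k → ι) (F : Flag l k) : ℂ :=
  ∑ s : Equiv.Perm (Fin k), if chain l (H ∘ s) = F.1 then ((Equiv.Perm.sign s : ℤ) : ℂ) else 0

lemma mem_chain (l : ι → AffForm m) {k : ℕ} (H : Fin k → ι) (i : Fin (k + 1)) (t : Fin m → ℂ) :
    t ∈ chain l H i ↔ ∀ j : Fin k, (j : ℕ) < i → (l (H j)).eval t = 0 := by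
  simp [chain, AffineSubspace.mem_iInf_iff, AffForm.mem_hyperplane]

lemma chain_comp_swap (l : ι → AffForm m) {k : ℕ} (H : Fin k → ι) {a b : Fin k}
    (hab : (b : ℕ) = a + 1) (j : Fin (k + 1)) (hj : (j : ℕ) ≠ b) :
    chain l (H ∘ Equiv.swap a b) j = chain l H j := by
  ext t
  simp only [mem_chain, Function.comp]
  have key : ∀ i : Fin k, ((Equiv.swap a b i : Fin k) : ℕ) < j ↔ (i : ℕ) < j := by
    intro i
    rcases eq_or_ne i a with rfl | ha
    · rw [Equiv.swap_apply_left]; omega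
    rcases eq_or_ne i b with rfl | hb
    · rw [Equiv.swap_apply_right]; omega
    · rw [Equiv.swap_apply_of_ne_of_ne ha hb]
  constructor
  · intro h i hi
    have := h (Equiv.swap a b i) ((key i).2 hi)
    simpa using this
  · intro h i hi
    exact h _ ((key i).2 hi)

lemma finrank_direction_le (L : AffineSubspace ℂ (Fin m → ℂ)) (f : AffForm m) {t : Fin m → ℂ}
    (hL : t ∈ L) (hf : t ∈ f.hyperplane) :
    Module.finrank ℂ L.direction ≤ Module.finrank ℂ (L ⊓ f.hyperplane).direction + 1 := by
  have h1 : L.direction ⊓ LinearMap.ker f.lin ≤ (L ⊓ f.hyperplane).direction := by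
    rintro v ⟨hv, hv'⟩
    have hv'' : f.lin v = 0 := hv'
    have h3 : v +ᵥ t ∈ f.hyperplane := by
      rw [AffForm.mem_hyperplane, AffForm.eval_eq] at *
      rw [vadd_eq_add, map_add, hv'', zero_add, hf]
    have h2 : v +ᵥ t ∈ L ⊓ f.hyperplane := ⟨AffineSubspace.vadd_mem_of_mem_direction hv hL, h3⟩
    have := AffineSubspace.vsub_mem_direction h2 (show t ∈ L ⊓ f.hyperplane from ⟨hL, hf⟩)
    simpa using this
  have h2 := LinearMap.finrank_range_add_finrank_ker (f.lin.domRestrict L.direction)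
  have h3 : Module.finrank ℂ (LinearMap.range (f.lin.domRestrict L.direction)) ≤ 1 :=
    (Submodule.finrank_le _).trans (by simp)
  have h4 : Module.finrank ℂ (LinearMap.ker (f.lin.domRestrict L.direction)) ≤
      Module.finrank ℂ (L ⊓ f.hyperplane).direction := by
    let g : LinearMap.ker (f.lin.domRestrict L.direction) →ₗ[ℂ] (L ⊓ f.hyperplane).direction :=
      { toFun := fun v => ⟨v.1.1, h1 ⟨v.1.2, v.2⟩⟩
        map_add' := fun _ _ => rfl
        map_smul' := fun _ _ => rfl }
    refine LinearMap.finrank_le_finrank_of_injective (f := g) ?_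
    intro v w hvw
    have h : ((g v : (L ⊓ f.hyperplane).direction) : Fin m → ℂ) = g w := by rw [hvw]
    exact Subtype.ext (Subtype.ext h)
  omega

lemma chain_succ (l : ι → AffForm m) {k : ℕ} (H : Fin k → ι) (b : Fin k) :
    chain l H b.succ = chain l H b.castSucc ⊓ (l (H b)).hyperplane := by
  ext t
  simp only [mem_chain, AffineSubspace.mem_inf_iff, AffForm.mem_hyperplane, Fin.val_succ,
    Fin.val_castSucc]
  constructor
  · exact fun h => ⟨fun j hj => h j (by omega), h b (by omega)⟩
  · rintro ⟨h, h'⟩ j hj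
    rcases Nat.lt_succ_iff_lt_or_eq.1 hj with hj | hj
    · exact h j hj
    · rwa [Fin.ext hj]

lemma chain_antitone (l : ι → AffForm m) {k : ℕ} (H : Fin k → ι) : Antitone (chain l H) := by
  intro i j hij t
  rw [mem_chain, mem_chain]
  exact fun h x hx => h x (lt_of_lt_of_le hx hij)

lemma isFlag_comp_swap (l : ι → AffForm m) {k : ℕ} (H : Fin k → ι) {a b : Fin k}
    (hab : (b : ℕ) = a + 1) (h : IsFlag l (chain l H)) :
    IsFlag l (chain l (H ∘ Equiv.swap a b)) := by
  have hne : ∀ j : Fin (k + 1), (chain l (H ∘ Equiv.swap a b) j : Set (Fin m → ℂ)).Nonempty := by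
    intro j
    obtain ⟨t, ht⟩ := (h.isEdge (Fin.last k)).1
    refine ⟨t, ?_⟩
    rw [SetLike.mem_coe, mem_chain] at *
    exact fun i _ => ht _ (by simp)
  refine ⟨chain_antitone _ _, fun j => ⟨hne j, ?_⟩, fun j => ?_⟩
  · refine ⟨{x | ∃ i : Fin k, (i : ℕ) < j ∧ (H ∘ Equiv.swap a b) i = x}, ?_⟩
    ext t
    simp only [mem_chain, AffineSubspace.mem_iInf_iff, AffForm.mem_hyperplane,
      Set.mem_ofPred_eq, forall_exists_index, and_imp]
    exact ⟨fun h x i hi hx => hx ▸ h i hi, fun h i hi => h _ i hi rfl⟩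
  · by_cases hj : (j : ℕ) = b
    · have hj' : j = a.succ := Fin.ext (by simp [hj, hab])
      have hjb : b.castSucc = a.succ := Fin.ext (by simp [hab])
      have e1 := chain_succ l (H ∘ Equiv.swap a b) a
      have e2 := chain_succ l (H ∘ Equiv.swap a b) b
      rw [chain_comp_swap l H hab a.castSucc (by simp [hab])] at e1
      rw [chain_comp_swap l H hab b.succ (by simp), hjb] at e2
      obtain ⟨t, ht⟩ := (h.isEdge b.succ).1
      have ht' : t ∈ chain l (H ∘ Equiv.swap a b) a.succ ⊓
          (l ((H ∘ Equiv.swap a b) b)).hyperplane := by rw [← e2]; exact ht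
      have d2 := finrank_direction_le _ _ ht'.1 ht'.2
      have ht'' := ht'.1
      rw [e1] at ht''
      have d1 := finrank_direction_le _ _ ht''.1 ht''.2
      rw [← e2] at d2
      rw [← e1] at d1
      have c1 := h.codim a.castSucc
      have c2 := h.codim b.succ
      unfold HasCodim at *
      rw [hj']
      simp only [Fin.val_castSucc, Fin.val_succ] at *
      omega
    · rw [chain_comp_swap l H hab j hj]
      exact h.codim j

/-- The pairing with a tuple of hyperplanes respects the flag relations. -/
lemma flagPairing_relation [Finite ι] (l : ι → AffForm m) {k : ℕ} (H : Fin k → ι) (F : Flag l k)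
    (i : Fin (k + 1)) (hi : 0 < (i : ℕ)) (hik : (i : ℕ) < k) :
    Finsupp.linearCombination ℂ (flagPairing l H) (flagRelation l F i) = 0 := by
  classical
  let b : Fin k := ⟨i, hik⟩
  let a : Fin k := ⟨i - 1, by omega⟩
  have hab : (b : ℕ) = a + 1 := by simp only [a, b]; omega
  have hne : a ≠ b := fun h => by rw [h] at hab; omega
  let Q : Equiv.Perm (Fin k) → Prop := fun s =>
    IsFlag l (chain l (H ∘ s)) ∧ ∀ j, j ≠ i → chain l (H ∘ s) j = F.1 j
  have hQ : ∀ s, Q s → Q (s * Equiv.swap a b) := by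
    rintro s ⟨h1, h2⟩
    have e : H ∘ ⇑(s * Equiv.swap a b) = (H ∘ s) ∘ Equiv.swap a b := rfl
    refine ⟨by rw [e]; exact isFlag_comp_swap l _ hab h1, fun j hj => ?_⟩
    rw [e, chain_comp_swap l _ hab j (fun h => hj (Fin.ext h))]
    exact h2 j hj
  have hQ' : ∀ s, Q (s * Equiv.swap a b) ↔ Q s := fun s =>
    ⟨fun h => by simpa [mul_assoc] using hQ _ h, hQ s⟩
  have step : Finsupp.linearCombination ℂ (flagPairing l H) (flagRelation l F i) =
      ∑ s : Equiv.Perm (Fin k), if Q s then ((Equiv.Perm.sign s : ℤ) : ℂ) else 0 := by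
    rw [flagRelation, map_sum]
    have : ∀ F' : Flag l k, Finsupp.linearCombination ℂ (flagPairing l H)
        (if ∀ j, j ≠ i → F'.1 j = F.1 j then Finsupp.single F' 1 else 0) =
        ∑ s : Equiv.Perm (Fin k), if (∀ j, j ≠ i → F'.1 j = F.1 j) ∧ chain l (H ∘ s) = F'.1
          then ((Equiv.Perm.sign s : ℤ) : ℂ) else 0 := by
      intro F'
      split_ifs with h
      · rw [Finsupp.linearCombination_single, one_smul, flagPairing]
        exact Finset.sum_congr rfl fun s _ => by simp only [and_iff_right h]
      · simp [h]
    rw [Finset.sum_congr rfl fun F' _ => this F', Finset.sum_comm]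
    refine Finset.sum_congr rfl fun s _ => ?_
    by_cases hs : Q s
    · rw [if_pos hs, Finset.sum_eq_single (⟨chain l (H ∘ s), hs.1⟩ : Flag l k)]
      · rw [if_pos ⟨hs.2, rfl⟩]
      · rintro F' - hF'
        rw [if_neg]
        rintro ⟨-, h⟩
        exact hF' (Subtype.ext h.symm)
      · simp
    · rw [if_neg hs]
      refine Finset.sum_eq_zero fun F' _ => if_neg ?_
      rintro ⟨h1, h2⟩
      exact hs ⟨h2 ▸ F'.2, fun j hj => by rw [h2]; exact h1 j hj⟩
  rw [step]
  have h := Equiv.sum_comp (Equiv.mulRight (Equiv.swap a b))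
    (fun s : Equiv.Perm (Fin k) => if Q s then ((Equiv.Perm.sign s : ℤ) : ℂ) else 0)
  simp only [Equiv.coe_mulRight, hQ', Equiv.Perm.sign_mul, Equiv.Perm.sign_swap hne] at h
  have h' : ∀ s : Equiv.Perm (Fin k), (if Q s then (((Equiv.Perm.sign s * -1 : ℤˣ) : ℤ) : ℂ) else 0)
      = -(if Q s then ((Equiv.Perm.sign s : ℤ) : ℂ) else 0) := by
    intro s; split_ifs <;> simp
  rw [Finset.sum_congr rfl fun s _ => h' s, Finset.sum_neg_distrib] at h
  exact self_eq_neg.1 h.symm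

/-- The pairing `⟨·, H_1 ∧ ⋯ ∧ H_k⟩` as a linear functional on the flag space. -/
noncomputable def pairing [Finite ι] (l : ι → AffForm m) {k : ℕ} (H : Fin k → ι) :
    FlagSpace l k →ₗ[ℂ] ℂ :=
  (flagRelations l k).liftQ (Finsupp.linearCombination ℂ (flagPairing l H)) <| by
    rw [flagRelations, Submodule.span_le]
    rintro v ⟨F, i, hi, hik, rfl⟩
    exact flagPairing_relation l H F i hi hik

/-- The map `𝓖 : 𝓕^k → (𝓕^k)^*` defined by the geometric form
`G(F, F') = ∑ ⟨F, H_1 ∧ ⋯ ∧ H_k⟩ ⟨F', H_1 ∧ ⋯ ∧ H_k⟩ a(H_1) ⋯ a(H_k)` of the arrangement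
`(l_x = 0)_{x : ι}` with weights `a`. The sum is over unordered `k`-tuples of hyperplanes: the
summand does not depend on the order, and vanishes if there is a repetition, so we sum over all
ordered tuples and divide by `k!`. -/
noncomputable def geometricMap [Fintype ι] (l : ι → AffForm m) (a : ι → ℂ) (k : ℕ) :
    FlagSpace l k →ₗ[ℂ] Module.Dual ℂ (FlagSpace l k) :=
  (k.factorial : ℂ)⁻¹ •
    ∑ H : Fin k → ι, (∏ j, a (H j)) • (pairing l H).smulRight (pairing l H)

/-- The function `u` on the complement of the arrangement such that
`d log l_{H_1} ∧ ⋯ ∧ d log l_{H_m} = u dt_1 ∧ ⋯ ∧ dt_m`. -/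
noncomputable def topCoeff (l : ι → AffForm m) (H : Fin m → ι) (t : Fin m → ℂ) : ℂ :=
  (Matrix.of fun p q => (l (H p)).coeff q).det / ∏ p, (l (H p)).eval t

/-- A function `f` on the complement of the arrangement, with values in a vector space, is rational
and regular at the point `p` of `ℂ^m`: it is a quotient of a (vector-valued) polynomial by a
polynomial that does not vanish at `p`. -/
def RegularAt {V : Type*} [AddCommGroup V] [Module ℂ V] (l : ι → AffForm m)
    (f : (Fin m → ℂ) → V) (p : Fin m → ℂ) : Prop :=
  ∃ Q : MvPolynomial (Fin m) ℂ, MvPolynomial.eval p Q ≠ 0 ∧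
    ∀ φ : Module.Dual ℂ V, ∃ P : MvPolynomial (Fin m) ℂ,
      ∀ t ∈ complement l, MvPolynomial.eval t Q * φ (f t) = MvPolynomial.eval t P

/-- `f` is regular on the hyperplane `S` of the arrangement: it is regular at every point of `S`
that lies on no other hyperplane of the arrangement. -/
def RegularOn {V : Type*} [AddCommGroup V] [Module ℂ V] (l : ι → AffForm m)
    (f : (Fin m → ℂ) → V) (S : Set (Fin m → ℂ)) : Prop :=
  ∀ p ∈ S, (∀ x, p ∈ (l x).hyperplane → ((l x).hyperplane : Set (Fin m → ℂ)) = S) →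
    RegularAt l f p

end Arrangement

/-! ## Cyclotomic discriminantal arrangements -/

namespace Cyclotomic

open Arrangement

variable {m N T : ℕ}

/-- Labels of the hyperplanes of the arrangement `𝓒_{0,N;m}`: an index `i` for `t_i = 0`;
a triple `(i, v, k)` for `t_i = ω^k z_v`; a pair `i < j` and `k` for `t_i = ω^k t_j`. -/
abbrev Label (m N T : ℕ) : Type :=
  Fin m ⊕ (Fin m × Fin N × Fin T) ⊕ ({p : Fin m × Fin m // p.1 < p.2} × Fin T)

/-- The equations of the hyperplanes of the arrangement `𝓒_{0,N;m}`. -/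
def form (ω : ℂ) (z : Fin N → ℂ) : Label m N T → AffForm m
  | .inl i => ⟨Pi.single i 1, 0⟩
  | .inr (.inl (i, v, k)) => ⟨Pi.single i 1, ω ^ (k : ℕ) * z v⟩
  | .inr (.inr (p, k)) => ⟨Pi.single p.1.1 1 - Pi.single p.1.2 (ω ^ (k : ℕ)), 0⟩

/-- The largest index `i` such that the coordinate `t_i` occurs in the equation. -/
def leading : Label m N T → Fin m
  | .inl i => i
  | .inr (.inl (i, _, _)) => i
  | .inr (.inr (p, _)) => p.1.2

open Classical in
/-- The canonical element `Θ` of `𝓕^m ⊗ 𝓐^m` is built by starting from the trivial flag and, for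
`i = m, m - 1, …, 1` in turn, summing over the hyperplanes `H_i` among `t_j = ω^k t_i` (`j < i`),
`t_i = 0` and `t_i = ω^k z_v`; at each step `H_i` is intersected with the last edge of the flag and
appended to the form. So it is the sum over all such choices of
`(ℂ^m ⊇ H_m ⊇ H_m ∩ H_{m-1} ⊇ ⋯ ⊇ H_m ∩ ⋯ ∩ H_1) ⊗ H_m ∧ H_{m-1} ∧ ⋯ ∧ H_1`.
Here `θ` is the function with values in `𝓕^m` such that `Θ = θ dt_1 ∧ ⋯ ∧ dt_m`. -/
noncomputable def theta (ω : ℂ) (z : Fin N → ℂ) (t : Fin m → ℂ) :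
    FlagSpace (form ω z : Label m N T → AffForm m) m :=
  ∑ c : Fin m → Label m N T,
    if ∀ i, leading (c i) = i then
      topCoeff (form ω z) (c ∘ Fin.rev) t • flagOf (form ω z) (c ∘ Fin.rev)
    else 0

end Cyclotomic

/-! ## Cartan data with a diagram automorphism, and the weight function -/

/-- A finite-dimensional complex vector space `𝔥` with a non-degenerate symmetric bilinear form,
linearly independent simple roots `α_1, …, α_R ∈ 𝔥^*`, and a diagram automorphism: a permutation
`σ` of the indices together with a linear automorphism of `𝔥` (the restriction to `𝔥` of the
automorphism of the Lie algebra `𝔤` with generators `E_i`, `F_i`, `H ∈ 𝔥`) that permutes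
the simple roots and the elements `H_i ∈ 𝔥` corresponding to them accordingly. -/
structure DiagramData (𝔥 : Type*) [AddCommGroup 𝔥] [Module ℂ 𝔥] [FiniteDimensional ℂ 𝔥]
    (R : ℕ) where
  bilin : LinearMap.BilinForm ℂ 𝔥
  symm : bilin.IsSymm
  nondegenerate : bilin.Nondegenerate
  root : Fin R → Module.Dual ℂ 𝔥
  root_linearIndependent : LinearIndependent ℂ root
  perm : Equiv.Perm (Fin R)
  auto : 𝔥 ≃ₗ[ℂ] 𝔥
  root_perm : ∀ i, root (perm i) ∘ₗ (auto : 𝔥 →ₗ[ℂ] 𝔥) = root i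
  auto_coroot : ∀ i, auto ((bilin.toDual nondegenerate).symm (root i)) =
    (bilin.toDual nondegenerate).symm (root (perm i))

namespace DiagramData

variable {𝔥 : Type*} [AddCommGroup 𝔥] [Module ℂ 𝔥] [FiniteDimensional ℂ 𝔥] {R : ℕ}
  (D : DiagramData 𝔥 R)

/-- The order `T` of the diagram automorphism. -/
noncomputable def order : ℕ := orderOf D.perm

/-- The symmetric bilinear form on `𝔥^*` induced by the form on `𝔥`. -/
noncomputable def dualForm (x y : Module.Dual ℂ 𝔥) : ℂ :=
  D.bilin ((D.bilin.toDual D.nondegenerate).symm x) ((D.bilin.toDual D.nondegenerate).symm y)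

/-- The action of `σ^k` on `𝔥^*`; by definition `(σ^k x)(σ^k h) = x(h)`. -/
def dualPow (k : ℕ) (x : Module.Dual ℂ 𝔥) : Module.Dual ℂ 𝔥 :=
  x ∘ₗ ((D.auto ^ k).symm : 𝔥 →ₗ[ℂ] 𝔥)

/-- The element `H_i` of `𝔥` with `x(H_i) = (α_i, x)` for all `x ∈ 𝔥^*`. -/
noncomputable def coroot (i : Fin R) : 𝔥 := (D.bilin.toDual D.nondegenerate).symm (D.root i)

lemma auto_pow_coroot (k : ℕ) (i : Fin R) :
    (D.auto ^ k) (D.coroot i) = D.coroot ((D.perm ^ k) i) := by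
  induction k with
  | zero => simp
  | succ k ih =>
    rw [pow_succ', pow_succ', LinearEquiv.mul_apply, ih, Equiv.Perm.mul_apply]
    exact D.auto_coroot _

/-- The subspace `𝔥^σ` of invariants. -/
def invariants : Submodule ℂ 𝔥 := LinearMap.eqLocus (D.auto : 𝔥 →ₗ[ℂ] 𝔥) LinearMap.id

/-- The average `(1/T) ∑_{k ∈ ℤ/T} σ^k H_i`, the projection of `H_i` to `𝔥^σ`. -/
noncomputable def invCoroot (i : Fin R) : D.invariants :=
  ⟨(D.order : ℂ)⁻¹ • ∑ k ∈ Finset.range D.order, (D.auto ^ k) (D.coroot i), by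
    have h : ∀ k, D.auto ((D.auto ^ k) (D.coroot i)) = (D.auto ^ (k + 1)) (D.coroot i) :=
      fun k => by rw [pow_succ', LinearEquiv.mul_apply]
    have h' : (D.auto ^ D.order) (D.coroot i) = (D.auto ^ 0) (D.coroot i) := by
      rw [auto_pow_coroot, auto_pow_coroot, order, pow_orderOf_eq_one, pow_zero]
    simp only [invariants, LinearMap.mem_eqLocus, LinearEquiv.coe_coe, map_smul, map_sum, h,
      LinearMap.id_apply]
    rw [← sub_eq_zero, ← smul_sub, ← Finset.sum_sub_distrib,
      Finset.sum_range_sub (fun k => (D.auto ^ k) (D.coroot i)), h', sub_self, smul_zero]⟩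

/-- The number `(α_i, Λ)` for a weight `Λ ∈ (𝔥^σ)^*`, where `(𝔥^σ)^*` is paired with `𝔥^*` by
means of the projection of `𝔥` to `𝔥^σ`. -/
noncomputable def invPairing (i : Fin R) (Λ : Module.Dual ℂ D.invariants) : ℂ := Λ (D.invCoroot i)

/-- `T_i`, the length of the cycle of `σ` through the index `i`. -/
noncomputable def cycleLength (i : Fin R) : ℕ := Function.minimalPeriod D.perm i

end DiagramData

namespace Cyclotomic

open Arrangement

variable {𝔥 : Type*} [AddCommGroup 𝔥] [Module ℂ 𝔥] [FiniteDimensional ℂ 𝔥] {R r N : ℕ}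

/-- The index `(i, n) = λ_1 + ⋯ + λ_{i-1} + n` in `{1, …, m}`, where `m = λ_1 + ⋯ + λ_r`. -/
def idx (lam : Fin r → ℕ) (i : Fin r) (n : Fin (lam i)) : Fin (∑ i, lam i) :=
  finSigmaFinEquiv ⟨i, n⟩

/-- The `i` such that a given index in `{1, …, m}` is of the form `(i, n)`. -/
def block (lam : Fin r → ℕ) (x : Fin (∑ i, lam i)) : Fin r := (finSigmaFinEquiv.symm x).1

/-- The weighting of the arrangement `𝓒_{0,N;m}` given by the Cartan data and the weights:
the weight of `t_{(i,n)} = 0` is `-(α_i, Λ_0)`, that of `t_{(i,n)} = ω^k z_v` is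
`-(α_i, σ^k Λ_v)`, and that of `t_{(i,n)} = ω^k t_{(j,p)}` is `(α_i, σ^k α_j)`, where
`α_i` stands for the simple root labelled by the chosen representative of the `i`-th cycle. -/
noncomputable def weight (D : DiagramData 𝔥 R) (rep : Fin r → Fin R)
    (Λ₀ : Module.Dual ℂ D.invariants) (Λ : Fin N → Module.Dual ℂ 𝔥) (lam : Fin r → ℕ) :
    Label (∑ i, lam i) N D.order → ℂ
  | .inl x => -D.invPairing (rep (block lam x)) Λ₀
  | .inr (.inl (x, v, k)) =>
      -D.dualForm (D.root (rep (block lam x))) (D.dualPow k (Λ v))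
  | .inr (.inr (p, k)) =>
      D.dualForm (D.root (rep (block lam p.1.1)))
        (D.dualPow k (D.root (rep (block lam p.1.2))))

/-- The underlying set of the group `ΣZ_λ = ∏_i Σ_{λ_i} ⋉ (ℤ/(T/T_i))^{λ_i}`. -/
abbrev SymGroup (D : DiagramData 𝔥 R) (rep : Fin r → Fin R) (lam : Fin r → ℕ) : Type :=
  ∀ i : Fin r, Equiv.Perm (Fin (lam i)) ×
    (Fin (lam i) → Fin (D.order / D.cycleLength (rep i)))

/-- The point `g⁻¹ · p`, where `ΣZ_λ` acts on the coordinate functions by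
`g · t_{(i,n)} = ω^{T_i k_n} t_{(i,s(n))}` for `g = (s, k)`, and `t(g⁻¹ · p) = (g · t)(p)`. -/
noncomputable def invAct (D : DiagramData 𝔥 R) (rep : Fin r → Fin R) (ω : ℂ) (lam : Fin r → ℕ)
    (g : SymGroup D rep lam) (p : Fin (∑ i, lam i) → ℂ) : Fin (∑ i, lam i) → ℂ := fun x =>
  let y := finSigmaFinEquiv.symm x
  ω ^ (D.cycleLength (rep y.1) * ((g y.1).2 y.2 : ℕ)) * p (idx lam y.1 ((g y.1).1 y.2))

/-- The character `χ(g) = ∏_i ω^{T_i (k_1 + ⋯ + k_{λ_i})}` of `ΣZ_λ`. -/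
noncomputable def chi (D : DiagramData 𝔥 R) (rep : Fin r → Fin R) (ω : ℂ) (lam : Fin r → ℕ)
    (g : SymGroup D rep lam) : ℂ :=
  ∏ i, ω ^ (D.cycleLength (rep i) * ∑ n, ((g i).2 n : ℕ))

/-- The symmetrized canonical element
`θ^{ΣZ_λ}(p) = |ΣZ_λ|⁻¹ ∑_g χ(g) θ(g⁻¹ · p)`. -/
noncomputable def thetaSym (D : DiagramData 𝔥 R) (rep : Fin r → Fin R) (ω : ℂ) (z : Fin N → ℂ)
    (lam : Fin r → ℕ) (p : Fin (∑ i, lam i) → ℂ) :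
    FlagSpace (form ω z : Label (∑ i, lam i) N D.order → AffForm _) (∑ i, lam i) :=
  (Fintype.card (SymGroup D rep lam) : ℂ)⁻¹ •
    ∑ g : SymGroup D rep lam, chi D rep ω lam g • theta ω z (invAct D rep ω lam g p)

/-- The weight function `Ψ = 𝓖 ∘ θ^{ΣZ_λ}`, a rational map from `ℂ^m` to the space
`𝓖(𝓕^m(𝓒_{0,N;m})^{ΣZ_λ}) ≅ L(Λ)_λ`, here regarded as a subspace of
`𝓕^m(𝓒_{0,N;m})^* ≅ 𝓐^m(𝓒_{0,N;m})`. -/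
noncomputable def weightFunction (D : DiagramData 𝔥 R) (rep : Fin r → Fin R) (ω : ℂ)
    (z : Fin N → ℂ) (Λ₀ : Module.Dual ℂ D.invariants) (Λ : Fin N → Module.Dual ℂ 𝔥)
    (lam : Fin r → ℕ) (p : Fin (∑ i, lam i) → ℂ) :
    Module.Dual ℂ
      (FlagSpace (form ω z : Label (∑ i, lam i) N D.order → AffForm _) (∑ i, lam i)) :=
  geometricMap (form ω z) (weight D rep Λ₀ Λ lam) (∑ i, lam i) (thetaSym D rep ω z lam p)

end Cyclotomic

/-! Expanding `geometricMap` writes Ψ as a sum over m-tuples K of hyperplanes: the product of the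
weights of K, times ⟨θ^Σ, K⟩, times the functional ⟨·, K⟩. The key point is that θ is canonical: on
the complement, ⟨θ(t), K⟩ equals the coefficient u_K(t) of the logarithmic form of K
(`pairing_theta`), whose denominator is the product of the equations in K. A tuple containing a
hyperplane of weight zero drops out, so only hyperplanes of nonzero weight can be poles.

Symmetrization does no harm. Composing an equation with g⁻¹ gives a nonzero constant times an
equation of equal weight (`exists_eval_form_invAct`), because σ preserves the pairings of simple
roots and its T_i-th power fixes the representative of the i-th cycle. Hence Ψ is regular term by
term off the hyperplanes of nonzero weight (`regularAt_weightFunction`). The statements about single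
hyperplanes follow, since a label's weight is determined by its hyperplane as a set.

Canonicity comes from induction on the number of variables (`topCoeff_eq_sum_chainPairing`). Partial
fractions of u_K in the last coordinate (`topCoeff_eq_sum_restrict`) have one term for each root
t_{m+1} = P: up to sign, 1/(t_{m+1} - P) times the coefficient of the remaining forms restricted to
that hyperplane. On the other side, each flag in θ starts with a hyperplane involving t_{m+1}; an
ordering of K yields this flag only if it starts with the same hyperplane and the restrictions of
its other members yield the rest of the flag (`chainPairing_cons_graph`). Restricted forms may be
rescaled, constant or repeated, so the induction runs over scalar multiples of differences of
"atoms" 0, ω^k z_v, ω^k t_a, a class closed under restriction. -/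

namespace AffForm

/-! ### Affine forms, graphs over the first m coordinates, and restriction to a graph -/

variable {m : ℕ}

lemma eq_of_coeff_of_const {f g : AffForm m} (h : f.coeff = g.coeff) (h' : f.const = g.const) :
    f = g := by
  cases f; cases g; simp_all

/-- The affine form `a * (t_{m+1} - P(t_1, …, t_m))` in one more variable. -/
def graph (a : ℂ) (P : AffForm m) : AffForm (m + 1) :=
  ⟨Fin.snoc (fun i => -(a * P.coeff i)) a, -(a * P.const)⟩

/-- The restriction of an affine form to the graph `t_{m+1} = P(t_1, …, t_m)`. -/
def restrict (P : AffForm m) (f : AffForm (m + 1)) : AffForm m :=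
  ⟨fun i => f.coeff i.castSucc + f.coeff (Fin.last m) * P.coeff i,
    f.const + f.coeff (Fin.last m) * P.const⟩

/-- An affine form in the first `m` variables as a form in `m + 1` variables. -/
def lift (f : AffForm m) : AffForm (m + 1) := ⟨Fin.snoc f.coeff 0, f.const⟩

/-- The difference of two affine forms, multiplied by a scalar. -/
def smulSub (u : ℂ) (P Q : AffForm m) : AffForm m :=
  ⟨u • (P.coeff - Q.coeff), u * (P.const - Q.const)⟩

lemma eval_graph (a : ℂ) (P : AffForm m) (t : Fin (m + 1) → ℂ) :
    (graph a P).eval t = a * (t (Fin.last m) - P.eval (Fin.init t)) := by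
  simp only [eval, graph, Fin.sum_univ_castSucc, Fin.snoc_castSucc, Fin.snoc_last, Fin.init,
    mul_sub, Finset.mul_sum, neg_mul, Finset.sum_neg_distrib, mul_assoc]
  ring

lemma eval_lift (f : AffForm m) (t : Fin (m + 1) → ℂ) :
    f.lift.eval t = f.eval (Fin.init t) := by
  simp [eval, lift, Fin.sum_univ_castSucc, Fin.init]

lemma eval_restrict (P : AffForm m) (f : AffForm (m + 1)) (t : Fin m → ℂ) :
    (restrict P f).eval t = f.eval (Fin.snoc t (P.eval t) : Fin (m + 1) → ℂ) := by
  simp only [eval, restrict, Fin.sum_univ_castSucc, Fin.snoc_castSucc, Fin.snoc_last, add_mul,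
    Finset.sum_add_distrib, mul_sub, Finset.mul_sum, mul_assoc]
  ring

lemma restrict_lift (P f : AffForm m) : restrict P f.lift = f :=
  eq_of_coeff_of_const (by ext; simp [restrict, lift]) (by simp [restrict, lift])

lemma restrict_smulSub (P : AffForm m) (u : ℂ) (A B : AffForm (m + 1)) :
    restrict P (smulSub u A B) = smulSub u (restrict P A) (restrict P B) :=
  eq_of_coeff_of_const (by ext; simp [restrict, smulSub]; ring) (by simp [restrict, smulSub]; ring)

/-- An affine form depends on the last variable through its last coefficient only. -/
lemma eval_snoc (f : AffForm (m + 1)) (t : Fin m → ℂ) (x y : ℂ) :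
    f.eval (Fin.snoc t x : Fin (m + 1) → ℂ) =
      f.eval (Fin.snoc t y : Fin (m + 1) → ℂ) + f.coeff (Fin.last m) * (x - y) := by
  simp only [eval, Fin.sum_univ_castSucc, Fin.snoc_castSucc, Fin.snoc_last]
  ring

lemma eval_eq_of_hyperplane_graph_eq {a b : ℂ} (hb : b ≠ 0) {P Q : AffForm m}
    (h : (graph a P).hyperplane = (graph b Q).hyperplane) (t : Fin m → ℂ) :
    P.eval t = Q.eval t := by
  have h1 : (Fin.snoc t (P.eval t) : Fin (m + 1) → ℂ) ∈ (graph a P).hyperplane := by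
    rw [mem_hyperplane, eval_graph]; simp
  rw [h, mem_hyperplane, eval_graph] at h1
  simpa [hb, sub_eq_zero] using h1

lemma coeff_last_ne_zero_of_hyperplane_eq {a : ℂ} (ha : a ≠ 0) {P : AffForm m}
    {f : AffForm (m + 1)} (h : f.hyperplane = (graph a P).hyperplane) :
    f.coeff (Fin.last m) ≠ 0 := by
  intro h0
  have h1 : (Fin.snoc 0 (P.eval 0) : Fin (m + 1) → ℂ) ∈ (graph a P).hyperplane := by
    rw [mem_hyperplane, eval_graph]; simp
  have h2 : (Fin.snoc 0 (P.eval 0 + 1) : Fin (m + 1) → ℂ) ∈ (graph a P).hyperplane := by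
    rw [← h, mem_hyperplane] at h1 ⊢
    rw [eval_snoc f 0 _ (P.eval 0), h1, h0]; simp
  rw [mem_hyperplane, eval_graph] at h2
  simp [ha] at h2

lemma hyperplane_graph {a b : ℂ} (ha : a ≠ 0) (hb : b ≠ 0) (P : AffForm m) :
    (graph a P).hyperplane = (graph b P).hyperplane := by
  ext t
  simp [mem_hyperplane, eval_graph, ha, hb]

lemma eq_of_eval_eq {P Q : AffForm m} (h : ∀ t, P.eval t = Q.eval t) : P = Q := by
  have h0 := h 0
  simp only [eval, Pi.zero_apply, mul_zero, Finset.sum_const_zero, zero_sub, neg_inj] at h0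
  refine eq_of_coeff_of_const (funext fun i => ?_) h0
  have := h (Pi.single i 1)
  simpa [eval, h0, Pi.single_apply] using this

/-- Adding `P.coeff q` times the last column to each earlier column q restricts the lower rows to
the graph and leaves only the entry a in the top row. Laplace expansion along that row gives the
sign. -/
lemma det_cons_graph (a : ℂ) (P : AffForm m) (K : Fin m → AffForm (m + 1)) :
    (Matrix.of fun p q => ((Fin.cons (graph a P) K : Fin (m + 1) → AffForm (m + 1)) p).coeff q).det
      = (-1) ^ m * a * (Matrix.of fun p q => (restrict P (K p)).coeff q).det := by
  let A : Matrix (Fin (m + 1)) (Fin (m + 1)) ℂ :=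
    Matrix.of fun p q => ((Fin.cons (graph a P) K : Fin (m + 1) → AffForm (m + 1)) p).coeff q
  let c : Fin (m + 1) → ℂ := Fin.snoc P.coeff 0
  let B : Matrix (Fin (m + 1)) (Fin (m + 1)) ℂ :=
    Matrix.of fun p q => A p q + c q * A p (Fin.last m)
  have hAB : A.det = B.det := by
    rw [← Matrix.det_transpose A, ← Matrix.det_transpose B]
    refine Matrix.det_eq_of_forall_row_eq_smul_add_const (fun i => -c i) (Fin.last m)
      (by simp [c]) fun i j => ?_
    simp [B, c]
  have h0 : ∀ j : Fin m, B 0 j.castSucc = 0 := fun j => by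
    simp [B, A, c, graph]; ring
  have hl : B 0 (Fin.last m) = a := by simp [B, A, c, graph]
  change A.det = _
  rw [hAB, Matrix.det_succ_row_zero, Fin.sum_univ_castSucc, Finset.sum_eq_zero, zero_add, hl,
    Fin.val_last]
  · congr 2
    ext i j
    simp [B, A, c, restrict, mul_comm]
  · intro j _
    rw [h0]; simp

end AffForm

/-! ### Partial fractions in one variable -/

/-- The partial fraction decomposition, in the variable `x`, of the inverse of a product of affine
functions of `x` with pairwise distinct roots. -/
lemma inv_prod_eq_sum_inv {ι : Type*} [Fintype ι] [DecidableEq ι] (f : ι → ℂ → ℂ) (a r : ι → ℂ)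
    (x : ℂ) (hf : ∀ i, a i ≠ 0 → ∀ y, f i y = a i * (y - r i))
    (hf0 : ∀ i, a i = 0 → ∀ y y', f i y = f i y') (hx : ∀ i, a i ≠ 0 → x ≠ r i)
    (hr : ∀ i j, a i ≠ 0 → a j ≠ 0 → r i = r j → i = j) (hne : ∃ i, a i ≠ 0) :
    (∏ i, f i x)⁻¹ =
      ∑ p, if a p = 0 then 0 else (f p x)⁻¹ * ∏ i ∈ Finset.univ.erase p, (f i (r p))⁻¹ := by
  set s : Finset ι := Finset.univ.filter fun i => a i ≠ 0 with hs
  -- The Lagrange basis polynomials at the distinct roots sum to 1. Multiplying the inverse product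
  -- by this identity cancels, in the p-th term, every factor except the p-th and replaces x by r p
  -- in the others.
  have hsum := Lagrange.sum_basis (s := s) (v := r)
    (fun i hi j hj h => hr i j (by simpa [hs] using hi) (by simpa [hs] using hj) h)
    (by obtain ⟨i, hi⟩ := hne; exact ⟨i, by simpa [hs] using hi⟩)
  have hsum' := congrArg (Polynomial.eval x) hsum
  rw [Polynomial.eval_finsetSum, Polynomial.eval_one] at hsum'
  rw [← mul_one (∏ i, f i x)⁻¹, ← hsum', Finset.mul_sum, hs, Finset.sum_filter]
  refine Finset.sum_congr rfl fun p _ => ?_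
  by_cases hp : a p = 0
  · simp [hp]
  rw [if_pos hp, if_neg hp, Lagrange.basis, Polynomial.eval_prod,
    ← Finset.mul_prod_erase _ _ (Finset.mem_univ p), mul_inv, mul_assoc]
  congr 1
  rw [← Finset.filter_erase, Finset.prod_filter, ← Finset.prod_inv_distrib,
    ← Finset.prod_mul_distrib]
  refine Finset.prod_congr rfl fun i hi => ?_
  have hip : i ≠ p := Finset.ne_of_mem_erase hi
  by_cases hai : a i = 0
  · rw [if_neg (by simpa using hai), mul_one, hf0 i hai x (r p)]
  · rw [if_pos hai, hf i hai, hf i hai]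
    have h1 : x - r i ≠ 0 := sub_ne_zero.2 (hx i hai)
    have h2 : r p - r i ≠ 0 := sub_ne_zero.2 fun h => hip (hr p i hp hai h).symm
    simp only [Lagrange.basisDivisor, Polynomial.eval_mul, Polynomial.eval_C, Polynomial.eval_sub,
      Polynomial.eval_X]
    field_simp

lemma prod_swap_succ {m : ℕ} (F : Fin (m + 1) → ℂ) (p : Fin (m + 1)) :
    ∏ i : Fin m, F (Equiv.swap 0 p i.succ) = ∏ i ∈ Finset.univ.erase p, F i := by
  -- Resetting the value at p to 1 turns the product over the other indices into a full product,
  -- which the swap reindexes.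
  have h1 := Equiv.prod_comp (Equiv.swap 0 p) (Function.update F p 1)
  rw [Fin.prod_univ_succ, Equiv.swap_apply_left, Function.update_self, one_mul,
    ← Finset.mul_prod_erase _ _ (Finset.mem_univ p), Function.update_self, one_mul] at h1
  have e1 : ∀ i : Fin m, Equiv.swap 0 p i.succ ≠ p := fun i h => by
    have := (Equiv.swap 0 p).injective (h.trans (Equiv.swap_apply_left 0 p).symm)
    exact Fin.succ_ne_zero i this
  rw [Finset.prod_congr rfl fun i _ => (Function.update_of_ne (e1 i) 1 F).symm, h1]
  exact Finset.prod_congr rfl fun i hi => Function.update_of_ne (Finset.ne_of_mem_erase hi) 1 F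

/-! ### Atoms and their behaviour under restriction -/

namespace Cyclotomic

open Arrangement

variable {m N T : ℕ} {ω : ℂ} {z : Fin N → ℂ}

/-- The affine functions `0`, `ω^k z_v` and `ω^k t_a`. The hyperplanes of the arrangement
`𝓒_{0,N;m}` are the zero loci of the differences of these. -/
inductive IsAtom (ω : ℂ) (z : Fin N → ℂ) : AffForm m → Prop
  | zero : IsAtom ω z ⟨0, 0⟩
  | point (k : ℤ) (v : Fin N) : IsAtom ω z ⟨0, -(ω ^ k * z v)⟩
  | coord (k : ℤ) (a : Fin m) : IsAtom ω z ⟨Pi.single a (ω ^ k), 0⟩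

/-- A scalar multiple of a difference of atoms. -/
def IsAtomDifference (ω : ℂ) (z : Fin N → ℂ) (f : AffForm m) : Prop :=
  ∃ (u : ℂ) (P Q : AffForm m), IsAtom ω z P ∧ IsAtom ω z Q ∧ f = AffForm.smulSub u P Q

lemma IsAtom.scale (hω : ω ≠ 0) {P : AffForm m} (hP : IsAtom ω z P) (k : ℤ) :
    IsAtom ω z (⟨ω ^ k • P.coeff, ω ^ k * P.const⟩ : AffForm m) := by
  cases hP with
  | zero => simpa using IsAtom.zero
  | point l v =>
    have := IsAtom.point (m := m) (ω := ω) (z := z) (k + l) v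
    simpa [zpow_add₀ hω, mul_assoc] using this
  | coord l a =>
    have := IsAtom.coord (m := m) (ω := ω) (z := z) (k + l) a
    simpa [zpow_add₀ hω, ← Pi.single_smul] using this

lemma IsAtom.lift {P : AffForm m} (hP : IsAtom ω z P) : IsAtom ω z P.lift := by
  cases hP with
  | zero =>
    convert IsAtom.zero using 1
    refine AffForm.eq_of_coeff_of_const (funext fun i => ?_) rfl
    refine Fin.lastCases ?_ (fun i => ?_) i <;> simp [AffForm.lift]
  | point l v =>
    convert IsAtom.point l v using 1
    refine AffForm.eq_of_coeff_of_const (funext fun i => ?_) rfl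
    refine Fin.lastCases ?_ (fun i => ?_) i <;> simp [AffForm.lift]
  | coord l a =>
    convert IsAtom.coord l a.castSucc using 1
    refine AffForm.eq_of_coeff_of_const (funext fun i => ?_) rfl
    refine Fin.lastCases ?_ (fun i => ?_) i <;> simp [AffForm.lift, Pi.single_apply]

lemma IsAtom.eq_lift_or {A : AffForm (m + 1)} (hA : IsAtom ω z A) :
    (∃ P, IsAtom ω z P ∧ A = P.lift) ∨
      ∃ k : ℤ, A = ⟨Pi.single (Fin.last m) (ω ^ k), 0⟩ := by
  cases hA with
  | zero =>
    refine Or.inl ⟨_, .zero, AffForm.eq_of_coeff_of_const (funext fun i => ?_) rfl⟩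
    refine Fin.lastCases ?_ (fun i => ?_) i <;> simp [AffForm.lift]
  | point l v =>
    refine Or.inl ⟨_, .point l v, AffForm.eq_of_coeff_of_const (funext fun i => ?_) rfl⟩
    refine Fin.lastCases ?_ (fun i => ?_) i <;> simp [AffForm.lift]
  | coord l a =>
    refine Fin.lastCases (Or.inr ⟨l, rfl⟩) (fun a => ?_) a
    refine Or.inl ⟨_, .coord l a, AffForm.eq_of_coeff_of_const (funext fun i => ?_) rfl⟩
    refine Fin.lastCases ?_ (fun i => ?_) i <;> simp [AffForm.lift, Pi.single_apply]

/-- Substituting P for the last coordinate turns ω^k t_{m+1} into ω^k P, and atoms are stable under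
multiplication by powers of ω. This is what makes the induction possible. -/
lemma IsAtom.restrict (hω : ω ≠ 0) {P : AffForm m} (hP : IsAtom ω z P) {A : AffForm (m + 1)}
    (hA : IsAtom ω z A) : IsAtom ω z (AffForm.restrict P A) := by
  rcases hA.eq_lift_or with ⟨Q, hQ, rfl⟩ | ⟨k, rfl⟩
  · rwa [AffForm.restrict_lift]
  · convert hP.scale hω k using 1
    refine AffForm.eq_of_coeff_of_const (funext fun i => ?_) ?_ <;> simp [AffForm.restrict]

lemma IsAtomDifference.restrict (hω : ω ≠ 0) {P : AffForm m} (hP : IsAtom ω z P)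
    {f : AffForm (m + 1)} (hf : IsAtomDifference ω z f) :
    IsAtomDifference ω z (AffForm.restrict P f) := by
  obtain ⟨u, A, B, hA, hB, rfl⟩ := hf
  exact ⟨u, _, _, hP.restrict hω hA, hP.restrict hω hB, AffForm.restrict_smulSub P u A B⟩

lemma IsAtomDifference.eq_graph (hω : ω ≠ 0) {f : AffForm (m + 1)} (hf : IsAtomDifference ω z f)
    (h : f.coeff (Fin.last m) ≠ 0) :
    ∃ P, IsAtom ω z P ∧ f = AffForm.graph (f.coeff (Fin.last m)) P := by
  -- Pulling ω^k out of u(ω^k t_{m+1} - P) exhibits the root ω^{-k} P, again an atom.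
  have key : ∀ (u : ℂ) (k : ℤ) (P : AffForm m),
      AffForm.smulSub u ⟨Pi.single (Fin.last m) (ω ^ k), 0⟩ P.lift =
        AffForm.graph (u * ω ^ k) ⟨ω ^ (-k) • P.coeff, ω ^ (-k) * P.const⟩ := by
    intro u k P
    have hk : ω ^ k ≠ 0 := zpow_ne_zero _ hω
    refine AffForm.eq_of_coeff_of_const (funext fun i => ?_) ?_
    · refine Fin.lastCases ?_ (fun i => ?_) i
      · simp [AffForm.smulSub, AffForm.graph, AffForm.lift]
      · simp [AffForm.smulSub, AffForm.graph, AffForm.lift]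
        field_simp
    · simp [AffForm.smulSub, AffForm.graph, AffForm.lift]
      field_simp
  obtain ⟨u, A, B, hA, hB, rfl⟩ := hf
  rcases hA.eq_lift_or with ⟨P, hP, rfl⟩ | ⟨k, rfl⟩ <;>
    rcases hB.eq_lift_or with ⟨Q, hQ, rfl⟩ | ⟨l, rfl⟩
  · simp [AffForm.smulSub, AffForm.lift] at h
  · refine ⟨_, hP.scale hω (-l), ?_⟩
    have e := key (-u) l P
    have e' : AffForm.smulSub u P.lift ⟨Pi.single (Fin.last m) (ω ^ l), 0⟩ =
        AffForm.smulSub (-u) ⟨Pi.single (Fin.last m) (ω ^ l), 0⟩ P.lift :=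
      AffForm.eq_of_coeff_of_const (by ext; simp [AffForm.smulSub]; ring)
        (by simp [AffForm.smulSub])
    rw [e', e]; simp [AffForm.graph]
  · refine ⟨_, hQ.scale hω (-k), ?_⟩
    rw [key u k Q]; simp [AffForm.graph]
  -- Both atoms are multiples of the last coordinate, so the root is the atom 0.
  · refine ⟨_, .zero, AffForm.eq_of_coeff_of_const (funext fun i => ?_) ?_⟩
    · refine Fin.lastCases ?_ (fun i => ?_) i <;> simp [AffForm.smulSub, AffForm.graph]
    · simp [AffForm.smulSub, AffForm.graph]

/-- Labels carry exponents in `Fin T`, while inverting and dividing powers of ω produces integer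
exponents; reduction modulo T passes between them. -/
lemma exists_fin_pow_eq_zpow (hω : IsPrimitiveRoot ω T) (hT : 0 < T) (n : ℤ) :
    ∃ k : Fin T, ω ^ (k : ℕ) = ω ^ n := by
  have hT' : (0 : ℤ) < T := by exact_mod_cast hT
  have h0 := Int.emod_nonneg n hT'.ne'
  refine ⟨⟨(n % T).toNat, ?_⟩, ?_⟩
  · have := Int.emod_lt_of_pos n hT'
    omega
  · have hω0 : ω ≠ 0 := hω.ne_zero hT.ne'
    simp only
    rw [← zpow_natCast, Int.toNat_of_nonneg h0]
    conv_rhs => rw [← Int.emod_add_mul_ediv n T, zpow_add₀ hω0, zpow_mul, zpow_natCast,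
      hω.pow_eq_one, one_zpow, mul_one]

lemma eval_form_inl (i : Fin m) (t : Fin m → ℂ) :
    (form ω z (.inl i : Label m N T)).eval t = t i := by
  simp [form, AffForm.eval, Pi.single_apply]

lemma eval_form_point (i : Fin m) (v : Fin N) (k : Fin T) (t : Fin m → ℂ) :
    (form ω z (.inr (.inl (i, v, k)) : Label m N T)).eval t = t i - ω ^ (k : ℕ) * z v := by
  simp [form, AffForm.eval, Pi.single_apply]

lemma eval_form_pair (p : {p : Fin m × Fin m // p.1 < p.2}) (k : Fin T) (t : Fin m → ℂ) :
    (form ω z (.inr (.inr (p, k)) : Label m N T)).eval t =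
      t p.1.1 - ω ^ (k : ℕ) * t p.1.2 := by
  simp [form, AffForm.eval, Pi.single_apply, sub_mul, Finset.sum_sub_distrib]

section Complement

variable (hω : IsPrimitiveRoot ω T) (hT : 0 < T) {t : Fin m → ℂ}
  (ht : t ∈ complement (form ω z : Label m N T → AffForm m))
include ht

lemma coord_ne_zero (a : Fin m) : t a ≠ 0 := fun h => ht (.inl a) (by
  rw [AffForm.mem_hyperplane, eval_form_inl, h])

include hω hT

lemma coord_ne_point (a : Fin m) (v : Fin N) (k : ℤ) : t a ≠ ω ^ k * z v := fun h => by
  obtain ⟨l, hl⟩ := exists_fin_pow_eq_zpow hω hT k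
  exact ht (.inr (.inl (a, v, l))) (by
    rw [AffForm.mem_hyperplane, eval_form_point, h, hl, sub_self])

lemma coord_ne_coord {a b : Fin m} (hab : a ≠ b) (k : ℤ) : t a ≠ ω ^ k * t b := fun h => by
  have hω0 : ω ≠ 0 := hω.ne_zero hT.ne'
  rcases lt_or_gt_of_ne hab with hab | hab
  · obtain ⟨l, hl⟩ := exists_fin_pow_eq_zpow hω hT k
    exact ht (.inr (.inr (⟨(a, b), hab⟩, l))) (by
      rw [AffForm.mem_hyperplane, eval_form_pair, h, hl, sub_self])
  · obtain ⟨l, hl⟩ := exists_fin_pow_eq_zpow hω hT (-k)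
    exact ht (.inr (.inr (⟨(b, a), hab⟩, l))) (by
      rw [AffForm.mem_hyperplane, eval_form_pair, hl]
      simp only
      rw [h, ← mul_assoc, ← zpow_add₀ hω0, neg_add_cancel, zpow_zero, one_mul, sub_self])

/-- Distinct atoms take distinct values at each point of the complement. -/
lemma IsAtom.eq_of_eval_eq {P Q : AffForm m} (hP : IsAtom ω z P)
    (hQ : IsAtom ω z Q) (h : P.eval t = Q.eval t) : P = Q := by
  have hω0 : ω ≠ 0 := hω.ne_zero hT.ne'
  have e1 : ∀ k a, (⟨Pi.single a (ω ^ k), 0⟩ : AffForm m).eval t = ω ^ (k : ℤ) * t a := by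
    intro k a; simp [AffForm.eval, Pi.single_apply]
  have e2 : ∀ c, (⟨0, c⟩ : AffForm m).eval t = -c := by intro c; simp [AffForm.eval]
  have e3 : ∀ (k l : ℤ) (x y : ℂ), ω ^ k * x = ω ^ l * y → x = ω ^ (l - k) * y := by
    intro k l x y hxy
    rw [zpow_sub₀ hω0]
    have hk : ω ^ k ≠ 0 := zpow_ne_zero _ hω0
    field_simp
    linear_combination hxy
  cases hP with
  | zero =>
    cases hQ with
    | zero => rfl
    | point l w => rw [e2, e2, neg_inj] at h; rw [← h]
    | coord l b =>
      rw [e2, e1, neg_zero] at h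
      exact absurd h.symm (mul_ne_zero (zpow_ne_zero _ hω0) (coord_ne_zero ht b))
  | point k v =>
    cases hQ with
    | zero => rw [e2, e2, neg_inj] at h; rw [h]
    | point l w => rw [e2, e2, neg_inj] at h; rw [h]
    | coord l b =>
      rw [e2, e1, neg_neg] at h
      exact absurd (e3 _ _ _ _ h.symm) (coord_ne_point hω hT ht b v _)
  | coord k a =>
    cases hQ with
    | zero =>
      rw [e2, e1, neg_zero] at h
      exact absurd h (mul_ne_zero (zpow_ne_zero _ hω0) (coord_ne_zero ht a))
    | point l w =>
      rw [e2, e1, neg_neg] at h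
      exact absurd (e3 _ _ _ _ h) (coord_ne_point hω hT ht a w _)
    | coord l b =>
      rw [e1, e1] at h
      by_cases hab : a = b
      · subst hab
        rw [mul_right_cancel₀ (coord_ne_zero ht a) h]
      · exact absurd (e3 _ _ _ _ h) (coord_ne_coord hω hT ht hab _)

end Complement

/-! ### Hyperplanes of the arrangement in m and in m + 1 variables -/

lemma isAtomDifference_form (x : Label m N T) : IsAtomDifference ω z (form ω z x) := by
  rcases x with i | ⟨i, v, k⟩ | ⟨p, k⟩
  · exact ⟨1, _, _, .coord 0 i, .zero, by simp [form, AffForm.smulSub]⟩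
  · exact ⟨1, _, _, .coord 0 i, .point k v, by simp [form, AffForm.smulSub]⟩
  · exact ⟨1, _, _, .coord 0 p.1.1, .coord k p.1.2, by simp [form, AffForm.smulSub]⟩

/-- The label of a hyperplane in `ℂ^m`, as a label of a hyperplane in `ℂ^{m+1}`. -/
def liftLabel : Label m N T → Label (m + 1) N T
  | .inl i => .inl i.castSucc
  | .inr (.inl (i, v, k)) => .inr (.inl (i.castSucc, v, k))
  | .inr (.inr (p, k)) => .inr (.inr (⟨(p.1.1.castSucc, p.1.2.castSucc), p.2⟩, k))

lemma liftLabel_injective : Function.Injective (liftLabel : Label m N T → Label (m + 1) N T) := by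
  rintro (i | ⟨i, v, k⟩ | ⟨⟨⟨a, b⟩, hab⟩, k⟩) (i' | ⟨i', v', k'⟩ | ⟨⟨⟨a', b'⟩, hab'⟩, k'⟩) h <;>
    simp_all [liftLabel]

lemma leading_liftLabel (x : Label m N T) : leading (liftLabel x) = (leading x).castSucc := by
  rcases x with i | ⟨i, v, k⟩ | ⟨p, k⟩ <;> rfl

lemma exists_liftLabel_eq {y : Label (m + 1) N T} {i : Fin m} (h : leading y = i.castSucc) :
    ∃ x : Label m N T, leading x = i ∧ liftLabel x = y := by
  rcases y with j | ⟨j, v, k⟩ | ⟨⟨⟨a, b⟩, hab⟩, k⟩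
  · simp only [leading] at h; subst h
    exact ⟨.inl i, rfl, rfl⟩
  · simp only [leading] at h; subst h
    exact ⟨.inr (.inl (i, v, k)), rfl, rfl⟩
  · simp only [leading] at h; subst h
    have ha : (a : ℕ) < m := lt_trans (show (a : ℕ) < i from hab) i.2
    exact ⟨.inr (.inr (⟨(⟨a, ha⟩, i), hab⟩, k)), rfl, rfl⟩

lemma form_liftLabel (x : Label m N T) : form ω z (liftLabel x) = (form ω z x).lift := by
  rcases x with i | ⟨i, v, k⟩ | ⟨p, k⟩ <;>
  · refine AffForm.eq_of_coeff_of_const (funext fun j => ?_) rfl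
    refine Fin.lastCases ?_ (fun j => ?_) j <;>
      simp [liftLabel, form, AffForm.lift, Pi.single_apply, (Fin.castSucc_lt_last _).ne']

lemma init_mem_complement {t : Fin (m + 1) → ℂ}
    (ht : t ∈ complement (form ω z : Label (m + 1) N T → AffForm (m + 1))) :
    Fin.init t ∈ complement (form ω z : Label m N T → AffForm m) := fun x hx =>
  ht (liftLabel x) (by
    rwa [AffForm.mem_hyperplane, form_liftLabel, AffForm.eval_lift])

lemma coeff_last_ne_zero_of_leading (hω : ω ≠ 0) {x : Label (m + 1) N T}
    (hx : leading x = Fin.last m) : (form ω z x).coeff (Fin.last m) ≠ 0 := by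
  rcases x with i | ⟨i, v, k⟩ | ⟨⟨⟨a, b⟩, hab⟩, k⟩
  · simp only [leading] at hx; subst hx; simp [form]
  · simp only [leading] at hx; subst hx; simp [form]
  · simp only [leading] at hx; subst hx
    have : a ≠ Fin.last m := ne_of_lt hab
    simp [form, this.symm, hω]

lemma exists_form_eq_graph (hω : IsPrimitiveRoot ω T) (hT : 0 < T) {P : AffForm m}
    (hP : IsAtom ω z P) : ∃ (x : Label (m + 1) N T) (a : ℂ), leading x = Fin.last m ∧ a ≠ 0 ∧
      form ω z x = AffForm.graph a P := by
  have hω0 : ω ≠ 0 := hω.ne_zero hT.ne'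
  cases hP with
  | zero =>
    refine ⟨.inl (Fin.last m), 1, rfl, one_ne_zero,
      AffForm.eq_of_coeff_of_const (funext fun j => ?_) (by simp [form, AffForm.graph])⟩
    refine Fin.lastCases ?_ (fun j => ?_) j <;> simp [form, AffForm.graph]
  | point k v =>
    obtain ⟨l, hl⟩ := exists_fin_pow_eq_zpow hω hT k
    refine ⟨.inr (.inl (Fin.last m, v, l)), 1, rfl, one_ne_zero,
      AffForm.eq_of_coeff_of_const (funext fun j => ?_) (by simp [form, AffForm.graph, hl])⟩
    refine Fin.lastCases ?_ (fun j => ?_) j <;> simp [form, AffForm.graph]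
  | coord k b =>
    obtain ⟨l, hl⟩ := exists_fin_pow_eq_zpow hω hT (-k)
    -- The label puts the smaller index first, whence the factor: t_b - ω^{-k} t_{m+1} = -ω^{-k}
    -- (t_{m+1} - ω^k t_b).
    refine ⟨.inr (.inr (⟨(b.castSucc, Fin.last m), b.castSucc_lt_last⟩, l)), -ω ^ (-k), rfl,
      neg_ne_zero.2 (zpow_ne_zero _ hω0),
      AffForm.eq_of_coeff_of_const (funext fun j => ?_) (by simp [form, AffForm.graph])⟩
    have hk : ω ^ k ≠ 0 := zpow_ne_zero _ hω0
    refine Fin.lastCases ?_ (fun j => ?_) j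
    · simp [form, AffForm.graph, hl]
    · by_cases hj : j = b <;> simp [form, AffForm.graph, hl, Pi.single_apply, hj, hk]

/-- The z_v are nonzero and lie in distinct orbits of multiplication by ω, so the roots attached to
distinct labels are distinct. With `exists_form_eq_graph`, the hyperplanes involving the last
coordinate correspond one to one to the atoms in the first m variables. -/
lemma eq_of_form_eq_graph (hω : IsPrimitiveRoot ω T) (hT : 0 < T) (hz : ∀ v, z v ≠ 0)
    (hzz : ∀ v w, v ≠ w → ∀ k : ℕ, z v ≠ ω ^ k * z w) {x y : Label (m + 1) N T}
    (hx : leading x = Fin.last m) (hy : leading y = Fin.last m) {a b : ℂ} {P : AffForm m}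
    (hxP : form ω z x = AffForm.graph a P) (hyP : form ω z y = AffForm.graph b P) : x = y := by
  have hω0 : ω ≠ 0 := hω.ne_zero hT.ne'
  have pw : ∀ {k l : Fin T}, ω ^ (k : ℕ) = ω ^ (l : ℕ) → k = l := fun {k l} h =>
    Fin.ext (hω.pow_inj k.2 l.2 h)
  have pt : ∀ {v w : Fin N} {k l : Fin T}, ω ^ (k : ℕ) * z v = ω ^ (l : ℕ) * z w →
      v = w ∧ k = l := by
    intro v w k l h
    have hvw : v = w := by
      by_contra hvw
      obtain ⟨j, hj⟩ := exists_fin_pow_eq_zpow hω hT ((l : ℤ) - k)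
      refine hzz v w hvw j ?_
      rw [hj, zpow_sub₀ hω0, zpow_natCast, zpow_natCast]
      field_simp
      linear_combination h
    subst hvw
    exact ⟨rfl, pw (mul_right_cancel₀ (hz v) h)⟩
  have pair : ∀ {c : Fin (m + 1)} {k : Fin T} {hc : c < Fin.last m} {e : ℂ},
      form ω z (.inr (.inr (⟨(c, Fin.last m), hc⟩, k)) : Label (m + 1) N T) = AffForm.graph e P →
      ∃ c₀ : Fin m, c = c₀.castSucc ∧ P.const = 0 ∧
        P.coeff = Pi.single c₀ (ω ^ (k : ℕ))⁻¹ := by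
    intro c k hc e h
    obtain ⟨c₀, rfl⟩ := Fin.exists_castSucc_eq.2 hc.ne
    have hk : ω ^ (k : ℕ) ≠ 0 := pow_ne_zero _ hω0
    have h1 : e = -ω ^ (k : ℕ) := by
      simpa [form, AffForm.graph] using (congrArg (fun f => f.coeff (Fin.last m)) h).symm
    have h2 : P.const = 0 := by
      simpa [form, AffForm.graph, h1, hk] using (congrArg (fun f => f.const) h).symm
    refine ⟨c₀, rfl, h2, funext fun i => ?_⟩
    have h3 : (Pi.single c₀ 1 : Fin m → ℂ) i = ω ^ (k : ℕ) * P.coeff i := by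
      simpa [form, AffForm.graph, h1, Pi.single_apply] using
        congrArg (fun f => f.coeff i.castSucc) h
    rw [Pi.single_apply] at h3 ⊢
    split_ifs at h3 ⊢
    · field_simp; linear_combination -h3
    · simpa [hk] using h3.symm
  have single : ∀ {w e : ℂ},
      (⟨Pi.single (Fin.last m) 1, w⟩ : AffForm (m + 1)) = AffForm.graph e P →
      P.coeff = 0 ∧ P.const = -w := by
    intro w e h
    have h1 : e = 1 := by
      simpa [AffForm.graph] using (congrArg (fun f => f.coeff (Fin.last m)) h).symm
    subst h1
    refine ⟨funext fun i => ?_, ?_⟩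
    · simpa [AffForm.graph] using (congrArg (fun f => f.coeff i.castSucc) h).symm
    · have h2 : w = -P.const := by simpa [AffForm.graph] using congrArg (fun f => f.const) h
      rw [h2, neg_neg]
  have ne : ∀ {c : Fin m} {k : Fin T}, (Pi.single c (ω ^ (k : ℕ))⁻¹ : Fin m → ℂ) ≠ 0 := by
    intro c k h
    rw [Pi.single_eq_zero_iff] at h
    exact inv_ne_zero (pow_ne_zero _ hω0) h
  rcases x with i | ⟨i, v, k⟩ | ⟨⟨⟨c, d⟩, hcd⟩, k⟩ <;>
    rcases y with i' | ⟨i', v', k'⟩ | ⟨⟨⟨c', d'⟩, hcd'⟩, k'⟩ <;>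
    simp only [leading] at hx hy <;> subst hx <;> subst hy
  · rfl
  · have h := (single hxP).2.symm.trans (single hyP).2
    simp [hω0, hz] at h
  · obtain ⟨_, _, _, h⟩ := pair hyP
    exact absurd (h.symm.trans (single hxP).1) ne
  · have h := (single hxP).2.symm.trans (single hyP).2
    simp [hω0, hz] at h
  · have h := (single hxP).2.symm.trans (single hyP).2
    obtain ⟨rfl, rfl⟩ := pt (neg_inj.1 h)
    rfl
  · obtain ⟨_, _, _, h⟩ := pair hyP
    exact absurd (h.symm.trans (single hxP).1) ne
  · obtain ⟨_, _, _, h⟩ := pair hxP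
    exact absurd (h.symm.trans (single hyP).1) ne
  · obtain ⟨_, _, _, h⟩ := pair hxP
    exact absurd (h.symm.trans (single hyP).1) ne
  · obtain ⟨c, rfl, -, h⟩ := pair hxP
    obtain ⟨c', rfl, -, h'⟩ := pair hyP
    have e := h.symm.trans h'
    have hcc : c = c' := by
      by_contra hne
      have e1 := congrFun e c
      simp [hne, hω0] at e1
    subst hcc
    have e1 := congrFun e c
    simp only [Pi.single_eq_same, inv_inj] at e1
    obtain rfl := pw e1
    rfl

end Cyclotomic

/-! ### Chains of intersections beginning with a graph -/

namespace Arrangement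

variable {m : ℕ}

lemma mem_chain_cons_succ {k : ℕ} (f : AffForm m) (K : Fin k → AffForm m) (i : Fin (k + 1))
    (t : Fin m → ℂ) :
    t ∈ chain id (Fin.cons f K : Fin (k + 1) → AffForm m) i.succ ↔
      f.eval t = 0 ∧ t ∈ chain id K i := by
  simp only [mem_chain, id, Fin.val_succ, Fin.forall_fin_succ (n := k), Fin.cons_zero,
    Fin.cons_succ, Fin.val_zero, Nat.succ_pos, true_imp_iff, Nat.add_lt_add_iff_right]

lemma chain_zero {ι : Type*} (l : ι → AffForm m) {k : ℕ} (H : Fin k → ι) : chain l H 0 = ⊤ := by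
  ext t; simp [mem_chain]

lemma chain_cons_one {k : ℕ} (f : AffForm m) (K : Fin k → AffForm m) :
    chain id (Fin.cons f K : Fin (k + 1) → AffForm m) (Fin.succ 0) = f.hyperplane := by
  ext t
  rw [mem_chain_cons_succ, chain_zero]
  simp [AffForm.mem_hyperplane]

/-- On the hyperplane `t_{m+1} = P(t_1, …, t_m)`, a sequence of intersections that starts with this
hyperplane is the sequence of intersections of the restricted forms. -/
lemma chain_cons_graph_eq_iff {a b : ℂ} (ha : a ≠ 0) (hb : b ≠ 0) (P : AffForm m)
    (K L : Fin m → AffForm (m + 1)) :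
    chain id (Fin.cons (AffForm.graph a P) K : Fin (m + 1) → AffForm (m + 1)) =
        chain id (Fin.cons (AffForm.graph b P) L : Fin (m + 1) → AffForm (m + 1)) ↔
      chain id (AffForm.restrict P ∘ K) = chain id (AffForm.restrict P ∘ L) := by
  have key : ∀ {a : ℂ} (_ : a ≠ 0) (K : Fin m → AffForm (m + 1)) (i : Fin (m + 1))
      (t : Fin m → ℂ), t ∈ chain id (AffForm.restrict P ∘ K) i ↔
        (Fin.snoc t (P.eval t) : Fin (m + 1) → ℂ) ∈
          chain id (Fin.cons (AffForm.graph a P) K : Fin (m + 1) → AffForm (m + 1)) i.succ := by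
    intro a ha K i t
    rw [mem_chain_cons_succ, AffForm.eval_graph]
    simp [mem_chain, AffForm.eval_restrict]
  have key' : ∀ {a : ℂ} (_ : a ≠ 0) (K : Fin m → AffForm (m + 1)) (i : Fin (m + 1))
      (t : Fin (m + 1) → ℂ),
      t ∈ chain id (Fin.cons (AffForm.graph a P) K : Fin (m + 1) → AffForm (m + 1)) i.succ ↔
        t (Fin.last m) = P.eval (Fin.init t) ∧
          Fin.init t ∈ chain id (AffForm.restrict P ∘ K) i := by
    intro a ha K i t
    rw [key ha]
    by_cases h : t (Fin.last m) = P.eval (Fin.init t)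
    · rw [← h, Fin.snoc_init_self]; simp [h]
    · rw [mem_chain_cons_succ, AffForm.eval_graph]
      simp [h, ha, sub_eq_zero]
  constructor
  · intro h
    ext i t
    rw [key ha, key hb, h]
  · intro h
    funext i
    refine Fin.cases ?_ (fun i => ?_) i
    · rw [chain_zero, chain_zero]
    · ext t
      rw [key' ha, key' hb, h]

open Classical in
/-- The alternating number of orderings of a tuple of affine forms whose sequence of intersections
is a given sequence of affine subspaces. -/
noncomputable def chainPairing {k : ℕ} (K : Fin k → AffForm m)
    (F : Fin (k + 1) → AffineSubspace ℂ (Fin m → ℂ)) : ℂ :=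
  ∑ s : Equiv.Perm (Fin k), if chain id (K ∘ s) = F then ((Equiv.Perm.sign s : ℤ) : ℂ) else 0

-- An ordering of K is a choice of its initial member p together with an ordering of the rest. The
-- initial hyperplane must be the given graph, and inside the graph the chain becomes a chain of
-- restricted forms. The swap of 0 and p accounts for the sign.
open Classical in
lemma chainPairing_cons_graph {a : ℂ} (ha : a ≠ 0) {P : AffForm m}
    (K : Fin (m + 1) → AffForm (m + 1)) (L : Fin m → AffForm m)
    (hK : ∀ p, (K p).hyperplane = (AffForm.graph a P).hyperplane →
      ∃ b, b ≠ 0 ∧ K p = AffForm.graph b P) :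
    chainPairing K (chain id (Fin.cons (AffForm.graph a P) fun i => (L i).lift :
        Fin (m + 1) → AffForm (m + 1))) =
      ∑ p, if (K p).hyperplane = (AffForm.graph a P).hyperplane then
        ((Equiv.Perm.sign (Equiv.swap 0 p) : ℤ) : ℂ) *
          chainPairing (fun i => AffForm.restrict P (K (Equiv.swap 0 p i.succ))) (chain id L)
        else 0 := by
  -- Permutations of m + 1 letters are split by their value at 0.
  rw [chainPairing, ← Equiv.sum_comp Equiv.Perm.decomposeFin.symm, Fintype.sum_prod_type]
  refine Finset.sum_congr rfl fun p _ => ?_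
  have hs : ∀ e, K ∘ Equiv.Perm.decomposeFin.symm (p, e) =
      Fin.cons (K p) fun i => K (Equiv.swap 0 p (e i).succ) := by
    intro e
    funext i
    refine Fin.cases ?_ (fun i => ?_) i <;> simp
  have hsgn : ∀ e, ((Equiv.Perm.sign (Equiv.Perm.decomposeFin.symm (p, e)) : ℤ) : ℂ) =
      ((Equiv.Perm.sign (Equiv.swap 0 p) : ℤ) : ℂ) * ((Equiv.Perm.sign e : ℤ) : ℂ) := by
    intro e
    rw [Equiv.Perm.decomposeFin.symm_sign, ← Equiv.Perm.decomposeFin_symm_of_one,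
      Equiv.Perm.decomposeFin.symm_sign]
    split_ifs <;> simp
  split_ifs with h
  · obtain ⟨b, hb, hKp⟩ := hK p h
    rw [chainPairing, Finset.mul_sum]
    refine Finset.sum_congr rfl fun e _ => ?_
    have e1 : (AffForm.restrict P ∘ fun i => (L i).lift) = L :=
      funext fun i => AffForm.restrict_lift P (L i)
    rw [hs, hsgn, mul_ite, mul_zero, hKp]
    refine if_congr ?_ rfl rfl
    rw [chain_cons_graph_eq_iff hb ha, e1]
    rfl
  · refine Finset.sum_eq_zero fun e _ => if_neg fun h' => h ?_
    rw [hs] at h'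
    rw [← chain_cons_one (K p), h', chain_cons_one]

/-- The scale a cancels, as in any logarithmic derivative; the sign comes from moving dt_{m+1} past
m other differentials. -/
lemma topCoeff_cons_graph (a : ℂ) (ha : a ≠ 0) (P : AffForm m) (L : Fin m → AffForm m)
    (t : Fin (m + 1) → ℂ) :
    topCoeff id (Fin.cons (AffForm.graph a P) fun i => (L i).lift :
        Fin (m + 1) → AffForm (m + 1)) t =
      (-1) ^ m * (t (Fin.last m) - P.eval (Fin.init t))⁻¹ * topCoeff id L (Fin.init t) := by
  have h := AffForm.det_cons_graph a P fun i => (L i).lift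
  simp only [AffForm.restrict_lift] at h
  simp only [topCoeff, id] at h ⊢
  rw [h, Fin.prod_univ_succ]
  simp only [Fin.cons_zero, Fin.cons_succ, AffForm.eval_lift, AffForm.eval_graph]
  field_simp

end Arrangement

/-! ### Canonicity of θ, by induction on the number of variables -/

namespace Cyclotomic

open Arrangement

variable {m N T : ℕ} {ω : ℂ} {z : Fin N → ℂ}

-- A hyperplane with a smaller leading index does not involve the last coordinate, so a choice of
-- hyperplanes in m + 1 variables is one for the last coordinate and a choice in m variables.
open Classical in
lemma sum_leading_succ (f : (Fin (m + 1) → Label (m + 1) N T) → ℂ) :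
    (∑ c : Fin (m + 1) → Label (m + 1) N T, if ∀ i, leading (c i) = i then f c else 0) =
      ∑ x : Label (m + 1) N T, if leading x = Fin.last m then
        ∑ c : Fin m → Label m N T, if ∀ i, leading (c i) = i then
          f (Fin.snoc (liftLabel ∘ c) x : Fin (m + 1) → Label (m + 1) N T) else 0 else 0 := by
  simp only [← Finset.sum_filter]
  rw [← Finset.sum_product']
  symm
  refine Finset.sum_bij (fun q _ => (Fin.snoc (liftLabel ∘ q.2) q.1 :
    Fin (m + 1) → Label (m + 1) N T)) ?_ ?_ ?_ fun _ _ => rfl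
  · rintro ⟨x, c⟩ h
    simp only [Finset.mem_product, Finset.mem_filter, Finset.mem_univ, true_and] at h ⊢
    intro i
    refine Fin.lastCases ?_ (fun i => ?_) i
    · simpa using h.1
    · simp [leading_liftLabel, h.2 i]
  · rintro ⟨x, c⟩ - ⟨x', c'⟩ - h
    have h1 := congrFun h (Fin.last m)
    simp only [Fin.snoc_last] at h1
    refine Prod.ext h1 (funext fun i => liftLabel_injective ?_)
    have h2 := congrFun h i.castSucc
    simpa only [Fin.snoc_castSucc, Function.comp] using h2
  · intro c hc
    simp only [Finset.mem_filter, Finset.mem_univ, true_and] at hc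
    choose c' hc' hc'' using fun i : Fin m => exists_liftLabel_eq (hc i.castSucc)
    refine ⟨(c (Fin.last m), c'), ?_, ?_⟩
    · simpa using ⟨hc _, hc'⟩
    · funext i
      refine Fin.lastCases ?_ (fun i => ?_) i
      · simp
      · simpa using hc'' i

lemma form_comp_snoc_rev (c : Fin m → Label m N T) (x : Label (m + 1) N T) :
    (form ω z ∘ (Fin.snoc (liftLabel ∘ c) x : Fin (m + 1) → Label (m + 1) N T) ∘ Fin.rev) =
      Fin.cons (form ω z x) fun i => (form ω z (c i.rev)).lift := by
  rw [Fin.snoc_comp_rev]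
  funext i
  refine Fin.cases ?_ (fun i => ?_) i <;> simp [form_liftLabel]

open Classical in
/-- The expansion of `topCoeff` in the last variable by partial fractions. -/
lemma topCoeff_eq_sum_restrict (hω : IsPrimitiveRoot ω T) (hT : 0 < T)
    (K : Fin (m + 1) → AffForm (m + 1)) (P : Fin (m + 1) → AffForm m)
    (hP : ∀ p, (K p).coeff (Fin.last m) ≠ 0 → IsAtom ω z (P p))
    (hK : ∀ p, (K p).coeff (Fin.last m) ≠ 0 →
      K p = AffForm.graph ((K p).coeff (Fin.last m)) (P p))
    {t : Fin (m + 1) → ℂ}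
    (ht : t ∈ complement (form ω z : Label (m + 1) N T → AffForm (m + 1))) :
    topCoeff id K t = ∑ p, if (K p).coeff (Fin.last m) = 0 then 0 else
      ((Equiv.Perm.sign (Equiv.swap 0 p) : ℤ) : ℂ) *
        ((-1) ^ m * (t (Fin.last m) - (P p).eval (Fin.init t))⁻¹ *
          topCoeff id (fun i => AffForm.restrict (P p) (K (Equiv.swap 0 p i.succ)))
            (Fin.init t)) := by
  set M : Matrix (Fin (m + 1)) (Fin (m + 1)) ℂ := Matrix.of fun p q => (K p).coeff q with hM
  -- Bringing row p to the top costs the sign of the swap, and that sign squares to 1.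
  have hdet : ∀ p, (K p).coeff (Fin.last m) ≠ 0 →
      ((Equiv.Perm.sign (Equiv.swap 0 p) : ℤ) : ℂ) * ((-1) ^ m * (K p).coeff (Fin.last m) *
        (Matrix.of fun i j =>
          (AffForm.restrict (P p) (K (Equiv.swap 0 p i.succ))).coeff j).det) = M.det := by
    intro p hp
    rw [← AffForm.det_cons_graph, ← hK p hp]
    have h := Matrix.det_permute (Equiv.swap 0 p) M
    have e : (Matrix.of fun i j => ((Fin.cons (K p) fun i => K (Equiv.swap 0 p i.succ) :
        Fin (m + 1) → AffForm (m + 1)) i).coeff j) = M.submatrix (Equiv.swap 0 p) id := by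
      ext i j
      refine Fin.cases ?_ (fun i => ?_) i <;> simp [hM]
    rw [e, h, ← mul_assoc, ← Int.cast_mul, Int.units_coe_mul_self, Int.cast_one, one_mul]
  have hterm : ∀ p, (K p).coeff (Fin.last m) ≠ 0 →
      ((Equiv.Perm.sign (Equiv.swap 0 p) : ℤ) : ℂ) *
        ((-1) ^ m * (t (Fin.last m) - (P p).eval (Fin.init t))⁻¹ *
          topCoeff id (fun i => AffForm.restrict (P p) (K (Equiv.swap 0 p i.succ)))
            (Fin.init t)) =
      M.det * (((K p).eval t)⁻¹ * ∏ i ∈ Finset.univ.erase p,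
        ((K i).eval (Fin.snoc (Fin.init t) ((P p).eval (Fin.init t)) : Fin (m + 1) → ℂ))⁻¹) := by
    intro p hp
    rw [← hdet p hp, topCoeff, ← prod_swap_succ (fun i => ((K i).eval
      (Fin.snoc (Fin.init t) ((P p).eval (Fin.init t)) : Fin (m + 1) → ℂ))⁻¹) p]
    have h1 : (K p).eval t =
        (K p).coeff (Fin.last m) * (t (Fin.last m) - (P p).eval (Fin.init t)) := by
      conv_lhs => rw [hK p hp]
      rw [AffForm.eval_graph]
    rw [h1]
    simp only [id, AffForm.eval_restrict, Finset.prod_inv_distrib]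
    field_simp
  by_cases hne : ∃ p, (K p).coeff (Fin.last m) ≠ 0
  -- Partial fractions need distinct roots, which may fail for dependent forms; but then both sides
  -- vanish.
  · by_cases hd : M.det = 0
    · rw [topCoeff]
      simp only [id]
      rw [← hM, hd, zero_div, Finset.sum_eq_zero]
      intro p _
      split_ifs with hp
      · rfl
      · rw [hterm p hp, hd, zero_mul]
    have hpf := inv_prod_eq_sum_inv
      (fun i x => (K i).eval (Fin.snoc (Fin.init t) x : Fin (m + 1) → ℂ))
      (fun i => (K i).coeff (Fin.last m)) (fun i => (P i).eval (Fin.init t)) (t (Fin.last m))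
      (fun i hi y => by
        have h1 := AffForm.eval_graph ((K i).coeff (Fin.last m)) (P i)
          (Fin.snoc (Fin.init t) y : Fin (m + 1) → ℂ)
        rwa [← hK i hi, Fin.snoc_last, Fin.init_snoc] at h1)
      (fun i hi y y' => by rw [AffForm.eval_snoc _ _ y y', hi, zero_mul, add_zero])
      (fun i hi h => by
        have h1 := IsAtom.eq_of_eval_eq hω hT ht (IsAtom.coord 0 (Fin.last m)) (hP i hi).lift
          (by rw [AffForm.eval_lift, ← h]; simp [AffForm.eval, Pi.single_apply])
        have h2 := congrArg (fun f => f.coeff (Fin.last m)) h1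
        simp [AffForm.lift] at h2)
      -- Equal root values at a point of the complement force equal atoms, hence proportional rows,
      -- contrary to `hd`.
      (fun i j hi hj h => by
        by_contra hij
        have h1 := IsAtom.eq_of_eval_eq hω hT (init_mem_complement ht) (hP i hi) (hP j hj) h
        refine hd ?_
        have e1 := hK i hi
        have e2 := hK j hj
        rw [← h1] at e2
        set a := (K i).coeff (Fin.last m)
        set b := (K j).coeff (Fin.last m)
        have e3 : M i = (a / b) • M j := by
          funext q
          simp only [hM, Matrix.of_apply, Pi.smul_apply, smul_eq_mul]
          rw [e1, e2]
          refine Fin.lastCases ?_ (fun q => ?_) q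
          · simp only [AffForm.graph, Fin.snoc_last]; field_simp
          · simp only [AffForm.graph, Fin.snoc_castSucc]; field_simp
        have e4 : M = M.updateRow i ((a / b) • M j) := by rw [← e3, Matrix.updateRow_eq_self]
        rw [e4, Matrix.det_updateRow_smul]
        refine mul_eq_zero_of_right _ (Matrix.det_zero_of_row_eq hij ?_)
        rw [Matrix.updateRow_self, Matrix.updateRow_ne (Ne.symm hij)])
      hne
    simp only [Fin.snoc_init_self] at hpf
    rw [topCoeff]
    simp only [id]
    rw [← hM, div_eq_mul_inv, hpf, Finset.mul_sum]
    refine Finset.sum_congr rfl fun p _ => ?_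
    split_ifs with hp
    · rw [mul_zero]
    · rw [hterm p hp]
  -- No form involves the last variable: the sum is empty and the determinant has a zero column.
  · push Not at hne
    rw [Finset.sum_eq_zero fun p _ => if_pos (hne p), topCoeff]
    simp only [id]
    rw [← hM, Matrix.det_eq_zero_of_column_eq_zero (A := M) (Fin.last m) fun i => hne i, zero_div]

open Classical in
/-- The rational function `topCoeff K` is the pairing of the tuple `K` with the canonical
element. -/
theorem topCoeff_eq_sum_chainPairing (hω : IsPrimitiveRoot ω T) (hT : 0 < T) (hz : ∀ v, z v ≠ 0)
    (hzz : ∀ v w, v ≠ w → ∀ k : ℕ, z v ≠ ω ^ k * z w) {m : ℕ} (K : Fin m → AffForm m)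
    (hK : ∀ i, IsAtomDifference ω z (K i)) (t : Fin m → ℂ)
    (ht : t ∈ complement (form ω z : Label m N T → AffForm m)) :
    topCoeff id K t = ∑ c : Fin m → Label m N T, if ∀ i, leading (c i) = i then
      topCoeff id (form ω z ∘ c ∘ Fin.rev) t *
        chainPairing K (chain id (form ω z ∘ c ∘ Fin.rev)) else 0 := by
  have hω0 : ω ≠ 0 := hω.ne_zero hT.ne'
  induction m with
  | zero =>
    have h1 : ∀ c : Fin 0 → Label 0 N T,
        chainPairing K (chain id (form ω z ∘ c ∘ Fin.rev)) = 1 := by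
      intro c
      have e : ∀ s : Equiv.Perm (Fin 0), K ∘ s = form ω z ∘ c ∘ Fin.rev :=
        fun s => Subsingleton.elim _ _
      simp [chainPairing, e]
    have h2 : ∀ L : Fin 0 → AffForm 0, topCoeff id L t = 1 := fun L => by simp [topCoeff]
    simp [h1, h2]
  | succ m ih =>
    have hx : ∀ x : Label (m + 1) N T, ∃ P : AffForm m, leading x = Fin.last m →
        IsAtom ω z P ∧ form ω z x =
          AffForm.graph ((form ω z x).coeff (Fin.last m)) P := by
      intro x
      by_cases h : leading x = Fin.last m
      · obtain ⟨P, h1, h2⟩ := (isAtomDifference_form x).eq_graph hω0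
          (coeff_last_ne_zero_of_leading hω0 h)
        exact ⟨P, fun _ => ⟨h1, h2⟩⟩
      · exact ⟨⟨0, 0⟩, fun h' => absurd h' h⟩
    choose Q hQ using hx
    have hp : ∀ p, ∃ P : AffForm m, (K p).coeff (Fin.last m) ≠ 0 →
        IsAtom ω z P ∧ K p = AffForm.graph ((K p).coeff (Fin.last m)) P := by
      intro p
      by_cases h : (K p).coeff (Fin.last m) = 0
      · exact ⟨⟨0, 0⟩, fun h' => absurd h h'⟩
      · obtain ⟨P, h1, h2⟩ := (hK p).eq_graph hω0 h
        exact ⟨P, fun _ => ⟨h1, h2⟩⟩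
    choose P hP using hp
    have ht' := init_mem_complement ht
    have hPQ : ∀ p x, leading x = Fin.last m →
        (K p).hyperplane = (form ω z x).hyperplane →
        (K p).coeff (Fin.last m) ≠ 0 ∧ P p = Q x := by
      intro p x hx h
      have ha := coeff_last_ne_zero_of_leading (z := z) hω0 hx
      have h1 : (K p).coeff (Fin.last m) ≠ 0 :=
        AffForm.coeff_last_ne_zero_of_hyperplane_eq ha (h.trans (by rw [← (hQ x hx).2]))
      refine ⟨h1, AffForm.eq_of_eval_eq
        (AffForm.eval_eq_of_hyperplane_graph_eq (a := (K p).coeff (Fin.last m)) ha ?_)⟩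
      rw [← (hP p h1).2, ← (hQ x hx).2, h]
    rw [sum_leading_succ, topCoeff_eq_sum_restrict hω hT K P (fun p h => (hP p h).1)
      (fun p h => (hP p h).2) ht]
    -- For a fixed hyperplane x of the last coordinate, the sum over the remaining choices is
    -- collapsed by the induction hypothesis applied to the forms restricted to x.
    have hstep : ∀ x : Label (m + 1) N T, leading x = Fin.last m →
        (∑ c : Fin m → Label m N T, if ∀ i, leading (c i) = i then
          topCoeff id (form ω z ∘ (Fin.snoc (liftLabel ∘ c) x :
              Fin (m + 1) → Label (m + 1) N T) ∘ Fin.rev) t *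
            chainPairing K (chain id (form ω z ∘ (Fin.snoc (liftLabel ∘ c) x :
              Fin (m + 1) → Label (m + 1) N T) ∘ Fin.rev)) else 0) =
        ∑ p, if (K p).hyperplane = (form ω z x).hyperplane then
          ((Equiv.Perm.sign (Equiv.swap 0 p) : ℤ) : ℂ) *
          ((-1) ^ m * (t (Fin.last m) - (Q x).eval (Fin.init t))⁻¹ *
          topCoeff id (fun i => AffForm.restrict (Q x) (K (Equiv.swap 0 p i.succ)))
            (Fin.init t)) else 0 := by
      intro x hx
      have ha := coeff_last_ne_zero_of_leading (z := z) hω0 hx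
      have hform := (hQ x hx).2
      have h1 : ∀ c : Fin m → Label m N T,
          topCoeff id (form ω z ∘ (Fin.snoc (liftLabel ∘ c) x :
              Fin (m + 1) → Label (m + 1) N T) ∘ Fin.rev) t *
            chainPairing K (chain id (form ω z ∘ (Fin.snoc (liftLabel ∘ c) x :
              Fin (m + 1) → Label (m + 1) N T) ∘ Fin.rev)) =
          ∑ p, if (K p).hyperplane = (form ω z x).hyperplane then
            ((Equiv.Perm.sign (Equiv.swap 0 p) : ℤ) : ℂ) *
            ((-1) ^ m * (t (Fin.last m) - (Q x).eval (Fin.init t))⁻¹ *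
            (topCoeff id (form ω z ∘ c ∘ Fin.rev) (Fin.init t) *
            chainPairing (fun i => AffForm.restrict (Q x) (K (Equiv.swap 0 p i.succ)))
              (chain id (form ω z ∘ c ∘ Fin.rev)))) else 0 := by
        intro c
        rw [form_comp_snoc_rev, hform, topCoeff_cons_graph _ ha (Q x)
          (fun i => form ω z (c i.rev)), chainPairing_cons_graph ha K
          (fun i => form ω z (c i.rev)), Finset.mul_sum]
        · refine Finset.sum_congr rfl fun p _ => ?_
          rw [mul_ite, mul_zero]
          refine if_congr Iff.rfl ?_ rfl
          simp only [Function.comp_def]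
          ring
        · intro p h
          obtain ⟨h2, h3⟩ := hPQ p x hx (h.trans (by rw [← hform]))
          exact ⟨_, h2, by rw [← h3, ← (hP p h2).2]⟩
      simp only [h1]
      have h2 : ∀ c : Fin m → Label m N T, ∀ g : Fin (m + 1) → ℂ,
          (if ∀ i, leading (c i) = i then ∑ p, g p else 0) =
            ∑ p, if ∀ i, leading (c i) = i then g p else 0 := by
        intro c g; split_ifs <;> simp
      simp only [h2]
      rw [Finset.sum_comm]
      refine Finset.sum_congr rfl fun p _ => ?_
      split_ifs with h
      · rw [ih (fun i => AffForm.restrict (Q x) (K (Equiv.swap 0 p i.succ)))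
          (fun i => (hK _).restrict hω0 (hQ x hx).1) _ ht', Finset.mul_sum, Finset.mul_sum]
        refine Finset.sum_congr rfl fun c _ => ?_
        split_ifs <;> simp
      · simp
    have hstep' : ∀ x : Label (m + 1) N T, ∀ f g : ℂ, (leading x = Fin.last m → f = g) →
        (if leading x = Fin.last m then f else 0) = if leading x = Fin.last m then g else 0 := by
      intro x f g h; split_ifs with hx
      · exact h hx
      · rfl
    rw [Finset.sum_congr rfl fun x _ => hstep' x _ _ (hstep x)]
    have h2 : ∀ x : Label (m + 1) N T, ∀ g : Fin (m + 1) → ℂ,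
        (if leading x = Fin.last m then ∑ p, g p else 0) =
          ∑ p, if leading x = Fin.last m then g p else 0 := by
      intro x g; split_ifs <;> simp
    simp only [h2]
    rw [Finset.sum_comm]
    refine Finset.sum_congr rfl fun p _ => ?_
    split_ifs with hp
    · refine (Finset.sum_eq_zero fun x _ => ?_).symm
      split_ifs with hx h
      · exact absurd hp (hPQ p x hx h).1
      · rfl
      · rfl
    -- Exactly one label x has the hyperplane of `K p`, so the sum over x reduces to the partial
    -- fraction term at p.
    · obtain ⟨x, a, hx, ha, hxa⟩ := exists_form_eq_graph hω hT (N := N) (hP p hp).1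
      have hKx : (K p).hyperplane = (form ω z x).hyperplane := by
        rw [(hP p hp).2, hxa, AffForm.hyperplane_graph hp ha]
      rw [Finset.sum_eq_single x]
      · rw [if_pos hx, if_pos hKx, (hPQ p x hx hKx).2]
      · intro y _ hyx
        split_ifs with hy h
        · refine absurd (eq_of_form_eq_graph hω hT hz hzz hx hy hxa
            (b := (form ω z y).coeff (Fin.last m)) ?_)
            (Ne.symm hyx)
          rw [(hPQ p y hy h).2]
          exact (hQ y hy).2
        · rfl
        · rfl
      · simp

end Cyclotomic

/-! ### Flags of independent hyperplanes -/

namespace Arrangement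

variable {m : ℕ} {ι : Type*}

/-- Invertibility gives a unique common point. The dimension falls from m to 0 in m steps, each by
at most one, so each by exactly one. -/
lemma isFlag_chain_of_det_ne_zero (l : ι → AffForm m) (H : Fin m → ι)
    (h : (Matrix.of fun p q => (l (H p)).coeff q).det ≠ 0) : IsFlag l (chain l H) := by
  set M : Matrix (Fin m) (Fin m) ℂ := Matrix.of fun p q => (l (H p)).coeff q with hM
  have hu : IsUnit M.det := isUnit_iff_ne_zero.2 h
  have hlin : ∀ j v, (l (H j)).lin v = M.mulVec v j := fun j v => rfl
  obtain ⟨t, ht⟩ : ∃ t, ∀ j, (l (H j)).eval t = 0 := by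
    refine ⟨M⁻¹.mulVec fun j => (l (H j)).const, fun j => ?_⟩
    rw [AffForm.eval_eq, hlin, Matrix.mulVec_mulVec, Matrix.mul_nonsing_inv _ hu,
      Matrix.one_mulVec, sub_self]
  have hmem : ∀ i, t ∈ chain l H i := fun i => (mem_chain l H i t).2 fun j _ => ht j
  have hstep : ∀ b : Fin m, Module.finrank ℂ (chain l H b.castSucc).direction ≤
      Module.finrank ℂ (chain l H b.succ).direction + 1 := by
    intro b
    rw [chain_succ]
    exact finrank_direction_le _ _ (hmem _) (ht b)
  have hzero : Module.finrank ℂ (chain l H 0).direction = m := by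
    have e : chain l H 0 = ⊤ := chain_zero l H
    rw [e, AffineSubspace.direction_top, finrank_top, Module.finrank_fin_fun]
  have hlast : Module.finrank ℂ (chain l H (Fin.last m)).direction = 0 := by
    have e : (chain l H (Fin.last m)).direction = ⊥ := by
      rw [Submodule.eq_bot_iff]
      intro v hv
      have h1 := AffineSubspace.vadd_mem_of_mem_direction hv (hmem (Fin.last m))
      rw [mem_chain] at h1
      have h2 : M.mulVec v = 0 := by
        funext j
        have h3 := h1 j (by simp)
        have h4 := ht j
        rw [AffForm.eval_eq] at h3 h4
        rw [vadd_eq_add, map_add] at h3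
        rw [← hlin, Pi.zero_apply]
        linear_combination h3 - h4
      have h5 := congrArg M⁻¹.mulVec h2
      rwa [Matrix.mulVec_mulVec, Matrix.nonsing_inv_mul _ hu, Matrix.one_mulVec,
        Matrix.mulVec_zero] at h5
    rw [e, finrank_bot]
  refine ⟨chain_antitone l H, fun j => ⟨⟨t, hmem j⟩, ?_⟩, fun j => le_antisymm ?_ ?_⟩
  · refine ⟨{x | ∃ i : Fin m, (i : ℕ) < j ∧ H i = x}, ?_⟩
    ext t
    simp only [mem_chain, AffineSubspace.mem_iInf_iff, AffForm.mem_hyperplane,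
      Set.mem_ofPred_eq, forall_exists_index, and_imp]
    exact ⟨fun h x i hi hx => hx ▸ h i hi, fun h i hi => h _ i hi rfl⟩
  · induction j using Fin.reverseInduction with
    | last => rw [hlast]; simp
    | cast b ih =>
      have := hstep b
      simp only [Fin.val_castSucc, Fin.val_succ] at *
      omega
  · induction j using Fin.induction with
    | zero => rw [hzero]; simp
    | succ b ih =>
      have := hstep b
      simp only [Fin.val_castSucc, Fin.val_succ] at *
      omega

open Classical in
lemma pairing_flagOf [Finite ι] (l : ι → AffForm m) {k : ℕ} (K H : Fin k → ι)
    (h : IsFlag l (chain l H)) :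
    pairing l K (flagOf l H) = chainPairing (l ∘ K) (chain id (l ∘ H)) := by
  rw [flagOf, dif_pos h, pairing, Submodule.mkQ_apply, Submodule.liftQ_apply,
    Finsupp.linearCombination_single, one_smul]
  rfl

/-! ### Closure properties of regularity at a point -/

section Regular

variable {V : Type*} [AddCommGroup V] [Module ℂ V] {l : ι → AffForm m} {p : Fin m → ℂ}

/-- Regularity only tests values on the complement, which is where the formula for ⟨θ, K⟩ is
available. -/
lemma RegularAt.congr {f g : (Fin m → ℂ) → V} (hf : RegularAt l f p)
    (h : ∀ t ∈ complement l, g t = f t) : RegularAt l g p := by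
  obtain ⟨Q, hQ, hP⟩ := hf
  refine ⟨Q, hQ, fun φ => ?_⟩
  obtain ⟨P, hP⟩ := hP φ
  exact ⟨P, fun t ht => by rw [h t ht, hP t ht]⟩

lemma regularAt_zero : RegularAt l (fun _ => (0 : V)) p :=
  ⟨1, by simp, fun φ => ⟨0, by simp⟩⟩

lemma RegularAt.add {f g : (Fin m → ℂ) → V} (hf : RegularAt l f p) (hg : RegularAt l g p) :
    RegularAt l (fun t => f t + g t) p := by
  obtain ⟨Q, hQ, hP⟩ := hf
  obtain ⟨Q', hQ', hP'⟩ := hg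
  refine ⟨Q * Q', by simpa using ⟨hQ, hQ'⟩, fun φ => ?_⟩
  obtain ⟨P, hP⟩ := hP φ
  obtain ⟨P', hP'⟩ := hP' φ
  refine ⟨P * Q' + Q * P', fun t ht => ?_⟩
  simp only [map_mul, map_add, ← hP t ht, ← hP' t ht]
  ring

lemma RegularAt.sum {κ : Type*} (s : Finset κ) {f : κ → (Fin m → ℂ) → V}
    (hf : ∀ i ∈ s, RegularAt l (f i) p) : RegularAt l (fun t => ∑ i ∈ s, f i t) p := by
  classical
  induction s using Finset.induction_on with
  | empty => simpa using regularAt_zero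
  | insert a s ha ih =>
    simp only [Finset.sum_insert ha]
    exact (hf a (Finset.mem_insert_self a s)).add
      (ih fun i hi => hf i (Finset.mem_insert_of_mem hi))

lemma RegularAt.const_smul {f : (Fin m → ℂ) → V} (hf : RegularAt l f p) (c : ℂ) :
    RegularAt l (fun t => c • f t) p := by
  obtain ⟨Q, hQ, hP⟩ := hf
  refine ⟨Q, hQ, fun φ => ?_⟩
  obtain ⟨P, hP⟩ := hP φ
  refine ⟨MvPolynomial.C c * P, fun t ht => ?_⟩
  simp only [map_smul, smul_eq_mul, map_mul, MvPolynomial.eval_C, ← hP t ht]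
  ring

lemma RegularAt.smul_const {f : (Fin m → ℂ) → ℂ} (hf : RegularAt l f p) (v : V) :
    RegularAt l (fun t => f t • v) p := by
  obtain ⟨Q, hQ, hP⟩ := hf
  obtain ⟨P, hP⟩ := hP LinearMap.id
  refine ⟨Q, hQ, fun φ => ⟨P * MvPolynomial.C (φ v), fun t ht => ?_⟩⟩
  have := hP t ht
  simp only [LinearMap.id_apply] at this
  simp only [map_smul, smul_eq_mul, map_mul, MvPolynomial.eval_C, ← this]
  ring

/-- The quotient of a constant by a product of equations of hyperplanes is regular off these
hyperplanes. -/
lemma regularAt_div_prod {n : ℕ} (c : ℂ) (u : Fin n → ℂ) (y : Fin n → ι)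
    (hu : ∀ j, u j ≠ 0) (hp : ∀ j, p ∉ (l (y j)).hyperplane) :
    RegularAt l (fun t => c / ∏ j, u j * (l (y j)).eval t) p := by
  have he : ∀ (f : AffForm m) t, MvPolynomial.eval t
      (∑ i, MvPolynomial.C (f.coeff i) * MvPolynomial.X i - MvPolynomial.C f.const) =
        f.eval t := by
    intro f t; simp [AffForm.eval]
  let Q : MvPolynomial (Fin m) ℂ := ∏ j, MvPolynomial.C (u j) *
    (∑ i, MvPolynomial.C ((l (y j)).coeff i) * MvPolynomial.X i -
      MvPolynomial.C (l (y j)).const)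
  have hQ : ∀ t, MvPolynomial.eval t Q = ∏ j, u j * (l (y j)).eval t := by
    intro t
    simp only [Q, map_prod, map_mul, he, MvPolynomial.eval_C]
  refine ⟨Q, ?_, fun φ => ⟨MvPolynomial.C (φ c), fun t ht => ?_⟩⟩
  · rw [hQ, Finset.prod_ne_zero_iff]
    exact fun j _ => mul_ne_zero (hu j) (hp j)
  · have hne : ∏ j, u j * (l (y j)).eval t ≠ 0 :=
      Finset.prod_ne_zero_iff.2 fun j _ => mul_ne_zero (hu j) (ht (y j))
    rw [hQ, MvPolynomial.eval_C, ← smul_eq_mul, ← map_smul, smul_eq_mul, mul_div_cancel₀ _ hne]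

end Regular

end Arrangement

/-! ### Pairing θ with a tuple of hyperplanes -/

namespace Cyclotomic

open Arrangement

variable {m N T : ℕ} {ω : ℂ} {z : Fin N → ℂ}

/-- The pairing of the canonical element with a tuple of hyperplanes. -/
theorem pairing_theta (hω : IsPrimitiveRoot ω T) (hT : 0 < T) (hz : ∀ v, z v ≠ 0)
    (hzz : ∀ v w, v ≠ w → ∀ k : ℕ, z v ≠ ω ^ k * z w) (K : Fin m → Label m N T)
    {t : Fin m → ℂ} (ht : t ∈ complement (form ω z : Label m N T → AffForm m)) :
    pairing (form ω z) K (theta ω z t) = topCoeff (form ω z) K t := by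
  classical
  have h := topCoeff_eq_sum_chainPairing hω hT hz hzz (form ω z ∘ K)
    (fun i => isAtomDifference_form (K i)) t ht
  change topCoeff (form ω z) K t = _ at h
  rw [h, theta, map_sum]
  refine Finset.sum_congr rfl fun c _ => ?_
  split_ifs with hc
  · rw [map_smul, smul_eq_mul]
    change topCoeff (form ω z) (c ∘ Fin.rev) t * _ = topCoeff (form ω z) (c ∘ Fin.rev) t * _
    -- `flagOf` is zero by default when the chain is not a flag. A zero determinant kills the
    -- coefficient anyway, and a nonzero one guarantees a flag.
    by_cases hd : (Matrix.of fun p q =>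
        (form ω z ((c ∘ Fin.rev) p)).coeff q : Matrix (Fin m) (Fin m) ℂ).det = 0
    · rw [topCoeff, hd]; simp
    · rw [pairing_flagOf _ _ _ (isFlag_chain_of_det_ne_zero _ _ hd)]
  · simp

end Cyclotomic

/-! ### Pairings of roots and weights under the diagram automorphism -/

namespace DiagramData

variable {𝔥 : Type*} [AddCommGroup 𝔥] [Module ℂ 𝔥] [FiniteDimensional ℂ 𝔥] {R : ℕ}
  (D : DiagramData 𝔥 R)

lemma order_pos : 0 < D.order := orderOf_pos D.perm

lemma dualForm_root (i : Fin R) (x : Module.Dual ℂ 𝔥) :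
    D.dualForm (D.root i) x = x (D.coroot i) := by
  rw [dualForm, D.symm.eq, coroot]
  exact LinearMap.BilinForm.apply_toDual_symm_apply _ _

/-- Pairing with α_i is evaluation at H_i, and σ permutes these elements; so k enters only through
the permutation σ^k. -/
lemma dualForm_root_dualPow (i : Fin R) (k : ℕ) (x : Module.Dual ℂ 𝔥) :
    D.dualForm (D.root i) (D.dualPow k x) = x (D.coroot ((D.perm ^ (-(k : ℤ))) i)) := by
  rw [dualForm_root, dualPow, LinearMap.comp_apply]
  congr 1
  have h := D.auto_pow_coroot k ((D.perm ^ (-(k : ℤ))) i)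
  rw [zpow_neg, zpow_natCast, ← Equiv.Perm.mul_apply, mul_inv_cancel, Equiv.Perm.one_apply] at h
  rw [zpow_neg, zpow_natCast, ← h]
  exact LinearEquiv.symm_apply_apply _ _

lemma root_coroot_comm (i j : Fin R) :
    D.root j (D.coroot i) = D.root i (D.coroot j) := by
  rw [← dualForm_root, ← dualForm_root, dualForm, dualForm, D.symm.eq]

lemma root_coroot_perm (i j : Fin R) :
    D.root (D.perm j) (D.coroot (D.perm i)) = D.root j (D.coroot i) := by
  have h : D.auto (D.coroot i) = D.coroot (D.perm i) := D.auto_coroot i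
  rw [← h]
  exact LinearMap.congr_fun (D.root_perm j) (D.coroot i)

/-- Roots and coroots are permuted compatibly, which suffices here: invariance of the form on all of
𝔥 is not assumed. -/
lemma root_coroot_perm_zpow (n : ℤ) (i j : Fin R) :
    D.root ((D.perm ^ n) j) (D.coroot ((D.perm ^ n) i)) = D.root j (D.coroot i) := by
  induction n using Int.induction_on generalizing i j with
  | zero => simp
  | succ n ih => rw [zpow_add_one, Equiv.Perm.mul_apply, Equiv.Perm.mul_apply, ih, root_coroot_perm]
  | pred n ih =>
    rw [zpow_sub_one, Equiv.Perm.mul_apply, Equiv.Perm.mul_apply, ih,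
      ← root_coroot_perm, ← Equiv.Perm.mul_apply, ← Equiv.Perm.mul_apply, mul_inv_cancel,
      Equiv.Perm.one_apply, Equiv.Perm.one_apply]

lemma perm_pow_cycleLength_mul (i : Fin R) (k : ℕ) :
    (D.perm ^ (D.cycleLength i * k)) i = i := by
  rw [← Equiv.Perm.iterate_eq_pow]
  exact ((Function.isPeriodicPt_minimalPeriod D.perm i).mul_const k)

variable {D} {ω : ℂ}

/-- The order of ω is the order of the permutation, so equal powers of ω have exponents congruent
modulo that order. -/
lemma perm_zpow_eq (hω : IsPrimitiveRoot ω D.order) {a b : ℤ} (h : ω ^ a = ω ^ b) :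
    D.perm ^ a = D.perm ^ b := by
  rw [← orderOf_dvd_sub_iff_zpow_eq_zpow]
  refine (hω.zpow_eq_one_iff_dvd _).1 ?_
  have hω0 : ω ≠ 0 := hω.ne_zero D.order_pos.ne'
  rw [zpow_sub₀ hω0, h, div_self (zpow_ne_zero _ hω0)]

/-- The number `(α_i, σ^k x)` depends on `k` through `ω^k` only. Moreover `k` may be shifted by
multiples of the length of the cycle of `i`. -/
lemma dualForm_root_dualPow_congr (hω : IsPrimitiveRoot ω D.order) {i : Fin R} {k k' a : ℕ}
    (ha : (D.perm ^ a) i = i) (h : ω ^ k' = ω ^ ((k : ℤ) - a)) (x : Module.Dual ℂ 𝔥) :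
    D.dualForm (D.root i) (D.dualPow k' x) = D.dualForm (D.root i) (D.dualPow k x) := by
  rw [dualForm_root_dualPow, dualForm_root_dualPow]
  have h1 : D.perm ^ (-(k' : ℤ)) = D.perm ^ (-(k : ℤ) + a) := by
    rw [← zpow_natCast] at h
    rw [zpow_neg, perm_zpow_eq hω h, ← zpow_neg]
    congr 1; ring
  rw [h1, zpow_add, Equiv.Perm.mul_apply, zpow_natCast, ha]

/-- The shift a is absorbed because σ^a fixes i; the shift b is moved to the other root by
invariance and absorbed because σ^b fixes j. -/
lemma dualForm_root_dualPow_root_congr (hω : IsPrimitiveRoot ω D.order) {i j : Fin R}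
    {k k' a b : ℕ} (ha : (D.perm ^ a) i = i) (hb : (D.perm ^ b) j = j)
    (h : ω ^ k' = ω ^ ((k : ℤ) + b - a)) :
    D.dualForm (D.root i) (D.dualPow k' (D.root j)) =
      D.dualForm (D.root i) (D.dualPow k (D.root j)) := by
  have e : (k : ℤ) + b - a = ((k + b : ℕ) : ℤ) - a := by push_cast; ring
  rw [e] at h
  rw [dualForm_root_dualPow_congr hω ha h, dualForm_root_dualPow, dualForm_root_dualPow,
    ← root_coroot_perm_zpow D (b : ℤ), zpow_natCast, hb]
  rw [← zpow_natCast, ← Equiv.Perm.mul_apply, ← zpow_add]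
  congr 5
  push_cast; ring

/-- Needed because t_x = ω^k t_y and t_y = ω^{-k} t_x are the same hyperplane, while a label fixes
the order of its two coordinates. -/
lemma dualForm_root_dualPow_root_symm (hω : IsPrimitiveRoot ω D.order) {i j : Fin R}
    {k k' : ℕ} (h : ω ^ k' = ω ^ (-(k : ℤ))) :
    D.dualForm (D.root j) (D.dualPow k' (D.root i)) =
      D.dualForm (D.root i) (D.dualPow k (D.root j)) := by
  rw [dualForm_root_dualPow, dualForm_root_dualPow, root_coroot_comm,
    ← root_coroot_perm_zpow D (k' : ℤ), ← Equiv.Perm.mul_apply, ← zpow_add, add_neg_cancel,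
    zpow_zero, Equiv.Perm.one_apply]
  rw [← zpow_natCast] at h
  rw [perm_zpow_eq hω h]

end DiagramData

/-! ### The symmetry group and regularity of the weight function -/

namespace Cyclotomic

open Arrangement

variable {𝔥 : Type*} [AddCommGroup 𝔥] [Module ℂ 𝔥] [FiniteDimensional ℂ 𝔥] {R r N : ℕ}
  {D : DiagramData 𝔥 R} {rep : Fin r → Fin R} {ω : ℂ} {z : Fin N → ℂ}
  {Λ₀ : Module.Dual ℂ D.invariants} {Λ : Fin N → Module.Dual ℂ 𝔥} {lam : Fin r → ℕ}

lemma block_idx (i : Fin r) (n : Fin (lam i)) : block lam (idx lam i n) = i := by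
  simp [block, idx]

/-- Up to a unit, the equation of a hyperplane is transformed by the symmetry group into the
equation of a hyperplane of the same weight. -/
lemma exists_eval_form_invAct (hω : IsPrimitiveRoot ω D.order) (g : SymGroup D rep lam)
    (x : Label (∑ i, lam i) N D.order) :
    ∃ (y : Label (∑ i, lam i) N D.order) (u : ℂ), u ≠ 0 ∧
      weight D rep Λ₀ Λ lam y = weight D rep Λ₀ Λ lam x ∧
      ∀ t, (form ω z x).eval (invAct D rep ω lam g t) = u * (form ω z y).eval t := by
  have hω0 : ω ≠ 0 := hω.ne_zero D.order_pos.ne'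
  let π : Fin (∑ i, lam i) → Fin (∑ i, lam i) := fun a =>
    idx lam (finSigmaFinEquiv.symm a).1 ((g (finSigmaFinEquiv.symm a).1).1
      (finSigmaFinEquiv.symm a).2)
  let e : Fin (∑ i, lam i) → ℕ := fun a =>
    D.cycleLength (rep (block lam a)) *
      ((g (finSigmaFinEquiv.symm a).1).2 (finSigmaFinEquiv.symm a).2 : ℕ)
  have hact : ∀ t a, invAct D rep ω lam g t a = ω ^ e a * t (π a) := fun _ _ => rfl
  have hπ : ∀ a, block lam (π a) = block lam a := fun a => block_idx _ _
  have he : ∀ a, (D.perm ^ e a) (rep (block lam a)) = rep (block lam a) := fun a =>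
    D.perm_pow_cycleLength_mul _ _
  have hinj : Function.Injective π := by
    have h1 : ∀ q q' : (i : Fin r) × Fin (lam i),
        (⟨q.1, (g q.1).1 q.2⟩ : (i : Fin r) × Fin (lam i)) = ⟨q'.1, (g q'.1).1 q'.2⟩ → q = q' := by
      rintro ⟨i, n⟩ ⟨j, n'⟩ h
      obtain rfl : i = j := congrArg Sigma.fst h
      have hn : n = n' := (g i).1.injective (eq_of_heq (Sigma.mk.inj h).2)
      rw [hn]
    exact fun a b hab => finSigmaFinEquiv.symm.injective (h1 _ _ (finSigmaFinEquiv.injective hab))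
  rcases x with a | ⟨a, v, k⟩ | ⟨⟨⟨a, b⟩, hab⟩, k⟩
  · refine ⟨.inl (π a), ω ^ e a, pow_ne_zero _ hω0, ?_, fun t => ?_⟩
    · simp only [weight, hπ]
    · rw [eval_form_inl, eval_form_inl, hact]
  · obtain ⟨k', hk'⟩ := exists_fin_pow_eq_zpow hω D.order_pos ((k : ℕ) - e a : ℤ)
    refine ⟨.inr (.inl (π a, v, k')), ω ^ e a, pow_ne_zero _ hω0, ?_, fun t => ?_⟩
    · simp only [weight, hπ]
      rw [DiagramData.dualForm_root_dualPow_congr hω (he a) hk']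
    · rw [eval_form_point, eval_form_point, hact, hk', zpow_sub₀ hω0, zpow_natCast, zpow_natCast]
      have := pow_ne_zero (e a) hω0
      field_simp
  · have hne : π a ≠ π b := fun h => (ne_of_lt hab) (hinj h)
    have hea := pow_ne_zero (e a) hω0
    have heb := pow_ne_zero (e b) hω0
    have hk := pow_ne_zero (k : ℕ) hω0
    obtain ⟨k', hk'⟩ := exists_fin_pow_eq_zpow hω D.order_pos ((k : ℕ) + e b - e a : ℤ)
    have hw := DiagramData.dualForm_root_dualPow_root_congr hω (he a) (he b) hk'
    rcases lt_or_gt_of_ne hne with hlt | hlt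
    · refine ⟨.inr (.inr (⟨(π a, π b), hlt⟩, k')), ω ^ e a, hea, ?_, fun t => ?_⟩
      · simp only [weight, hπ]
        exact hw
      · rw [eval_form_pair, eval_form_pair, hact, hact, hk', zpow_sub₀ hω0, zpow_add₀ hω0,
          zpow_natCast, zpow_natCast, zpow_natCast]
        field_simp
    -- The permutation reversed the order of the two indices, so the equation is solved for the
    -- other coordinate: the exponent changes sign and -ω^{k + e b} comes out as the unit.
    · obtain ⟨k'', hk''⟩ := exists_fin_pow_eq_zpow hω D.order_pos (-((k' : ℕ) : ℤ))
      refine ⟨.inr (.inr (⟨(π b, π a), hlt⟩, k'')), -(ω ^ ((k : ℕ) + e b)),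
        neg_ne_zero.2 (pow_ne_zero _ hω0), ?_, fun t => ?_⟩
      · simp only [weight, hπ]
        rw [DiagramData.dualForm_root_dualPow_root_symm hω hk'']
        exact hw
      · rw [eval_form_pair, eval_form_pair, hact, hact, hk'', zpow_neg, zpow_natCast, hk',
          zpow_sub₀ hω0, zpow_add₀ hω0, zpow_natCast, zpow_natCast, zpow_natCast, pow_add]
        simp only
        field_simp
        ring

lemma invAct_mem_complement (hω : IsPrimitiveRoot ω D.order) (g : SymGroup D rep lam)
    {t : Fin (∑ i, lam i) → ℂ}
    (ht : t ∈ complement (form ω z : Label (∑ i, lam i) N D.order → AffForm _)) :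
    invAct D rep ω lam g t ∈
      complement (form ω z : Label (∑ i, lam i) N D.order → AffForm _) := by
  intro x hx
  -- Only the factorization of the equation matters here, so the weights are taken to be zero.
  obtain ⟨y, u, hu, -, h⟩ := exists_eval_form_invAct (z := z) (Λ₀ := 0) (Λ := 0) hω g x
  rw [AffForm.mem_hyperplane, h] at hx
  exact ht y ((mul_eq_zero.1 hx).resolve_left hu)

/-- The weight function is regular off the hyperplanes of nonzero weight. -/
theorem regularAt_weightFunction (hω : IsPrimitiveRoot ω D.order) (hz : ∀ v, z v ≠ 0)
    (hzz : ∀ v w, v ≠ w → ∀ k : ℕ, z v ≠ ω ^ k * z w) {p : Fin (∑ i, lam i) → ℂ}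
    (hp : ∀ x : Label (∑ i, lam i) N D.order,
      weight D rep Λ₀ Λ lam x ≠ 0 → p ∉ (form ω z x).hyperplane) :
    RegularAt (form ω z : Label (∑ i, lam i) N D.order → AffForm (∑ i, lam i))
      (weightFunction D rep ω z Λ₀ Λ lam) p := by
  set a := weight D rep Λ₀ Λ lam (N := N) with ha
  -- This explicit sum agrees with Ψ on the complement. Each term either has a vanishing product of
  -- weights, or has a denominator made of equations of nonzero weight.
  have hreg : RegularAt (form ω z : Label (∑ i, lam i) N D.order → AffForm (∑ i, lam i))
      (fun t => ((∑ i, lam i).factorial : ℂ)⁻¹ •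
        ∑ K : Fin (∑ i, lam i) → Label (∑ i, lam i) N D.order,
          (((∏ j, a (K j)) * (Fintype.card (SymGroup D rep lam) : ℂ)⁻¹) •
            ∑ g : SymGroup D rep lam, chi D rep ω lam g •
              topCoeff (form ω z) K (invAct D rep ω lam g t)) • pairing (form ω z) K) p := by
    refine RegularAt.const_smul (RegularAt.sum _ fun K _ => RegularAt.smul_const ?_ _) _
    by_cases hK : ∏ j, a (K j) = 0
    · simp only [hK, zero_mul, zero_smul]
      exact regularAt_zero
    refine RegularAt.const_smul (RegularAt.sum _ fun g _ => RegularAt.const_smul ?_ _) _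
    choose y u hu hy he using fun j =>
      exists_eval_form_invAct (z := z) (Λ₀ := Λ₀) (Λ := Λ) hω g (K j)
    simp only [topCoeff, he]
    refine regularAt_div_prod _ u y hu fun j => hp _ ?_
    have h1 : a (K j) ≠ 0 := fun h => hK (Finset.prod_eq_zero (Finset.mem_univ j) h)
    rwa [ha, hy j]
  refine hreg.congr fun t ht => ?_
  rw [weightFunction, geometricMap, LinearMap.smul_apply, LinearMap.sum_apply]
  congr 1
  refine Finset.sum_congr rfl fun K _ => ?_
  rw [LinearMap.smul_apply, LinearMap.smulRight_apply, smul_smul]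
  congr 1
  rw [thetaSym, map_smul, map_sum, smul_eq_mul, smul_eq_mul, mul_assoc]
  congr 2
  refine Finset.sum_congr rfl fun g _ => ?_
  rw [map_smul, pairing_theta hω D.order_pos hz hzz K (invAct_mem_complement hω g ht)]

/-! ### Reading the weight off a hyperplane given as a set -/

lemma weight_of_hyperplane_eq_pair (hω : IsPrimitiveRoot ω D.order) (hz : ∀ v, z v ≠ 0)
    {a b : Fin (∑ i, lam i)} (hab : a ≠ b) (k : ℕ) {x : Label (∑ i, lam i) N D.order}
    (hx : ((form ω z x).hyperplane : Set (Fin (∑ i, lam i) → ℂ)) = {t | t a = ω ^ k * t b}) :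
    weight D rep Λ₀ Λ lam x =
      D.dualForm (D.root (rep (block lam a))) (D.dualPow k (D.root (rep (block lam b)))) := by
  have hω0 : ω ≠ 0 := hω.ne_zero D.order_pos.ne'
  have hmem : ∀ t : Fin (∑ i, lam i) → ℂ, (form ω z x).eval t = 0 ↔ t a = ω ^ k * t b :=
    fun t => Set.ext_iff.1 hx t
  rcases x with c | ⟨c, v, l⟩ | ⟨⟨⟨c, d⟩, hcd⟩, l⟩
  -- A point of the hyperplane with no zero coordinate rules out t_c = 0.
  · have h := (hmem (Function.update (fun _ => 1) a (ω ^ k))).2 (by simp [hab.symm])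
    rw [eval_form_inl, Function.update_apply] at h
    split_ifs at h
    · exact absurd h (pow_ne_zero _ hω0)
    · exact absurd h one_ne_zero
  · have h := (hmem 0).2 (by simp)
    rw [eval_form_point] at h
    simp [hω0, hz] at h
  · have hcd' : c ≠ d := ne_of_lt hcd
    simp only [eval_form_pair, sub_eq_zero] at hmem
    have hl := pow_ne_zero (l : ℕ) hω0
    have hk := pow_ne_zero k hω0
    -- This point, supported at a and b, excludes a pair {c, d} with c in {a, b} and d outside it.
    -- If {c, d} = {a, b}, it fixes ω^l as ω^k or as its inverse, according to the order.
    have h1 := (hmem (Pi.single a (ω ^ k) + Pi.single b 1)).2 (by simp [hab, hab.symm])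
    simp only [Pi.add_apply, Pi.single_apply] at h1
    by_cases hca : c = a
    · subst hca
      by_cases hdb : d = b
      · subst hdb
        simp [hab, hab.symm] at h1
        simp only [weight]
        refine DiagramData.dualForm_root_dualPow_congr hω (a := 0) rfl ?_ _
        simp [h1]
      · simp [hab, hcd'.symm, hdb, hω0] at h1
    · by_cases hcb : c = b
      · subst hcb
        by_cases hda : d = a
        · subst hda
          simp [hcd', hcd'.symm] at h1
          simp only [weight]
          refine DiagramData.dualForm_root_dualPow_root_symm hω ?_
          rw [zpow_neg, zpow_natCast]
          exact eq_inv_of_mul_eq_one_left h1.symm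
        · simp [hab.symm, hcd'.symm, hda] at h1
      · have h2 := (hmem (Pi.single c 1)).2 (by simp [Ne.symm hca, Ne.symm hcb])
        simp [hcd'.symm] at h2

lemma weight_of_hyperplane_eq_point (hω : IsPrimitiveRoot ω D.order) (hz : ∀ v, z v ≠ 0)
    (hzz : ∀ v w, v ≠ w → ∀ k : ℕ, z v ≠ ω ^ k * z w)
    {a : Fin (∑ i, lam i)} (v : Fin N) (k : ℕ) {x : Label (∑ i, lam i) N D.order}
    (hx : ((form ω z x).hyperplane : Set (Fin (∑ i, lam i) → ℂ)) = {t | t a = ω ^ k * z v}) :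
    weight D rep Λ₀ Λ lam x =
      -D.dualForm (D.root (rep (block lam a))) (D.dualPow k (Λ v)) := by
  have hω0 : ω ≠ 0 := hω.ne_zero D.order_pos.ne'
  have hmem : ∀ t : Fin (∑ i, lam i) → ℂ, (form ω z x).eval t = 0 ↔ t a = ω ^ k * z v :=
    fun t => Set.ext_iff.1 hx t
  have h0 : ω ^ k * z v ≠ 0 := mul_ne_zero (pow_ne_zero _ hω0) (hz v)
  rcases x with c | ⟨c, w, l⟩ | ⟨⟨⟨c, d⟩, hcd⟩, l⟩
  · have h := (hmem 0).1 (by rw [eval_form_inl]; rfl)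
    exact absurd h.symm h0
  -- Only coordinate c of this point can be nonzero, while membership requires a nonzero coordinate
  -- a; so c = a, and the orbit condition on z gives w = v.
  · have h := (hmem (Pi.single c (ω ^ (l : ℕ) * z w))).1 (by rw [eval_form_point]; simp)
    rw [Pi.single_apply] at h
    split_ifs at h with hac
    · subst hac
      have hvw : w = v := by
        by_contra hvw
        obtain ⟨j, hj⟩ := exists_fin_pow_eq_zpow hω D.order_pos ((k : ℤ) - (l : ℕ))
        refine hzz w v hvw j ?_
        rw [hj, zpow_sub₀ hω0, zpow_natCast, zpow_natCast]
        have hl := pow_ne_zero (l : ℕ) hω0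
        field_simp
        linear_combination h
      subst hvw
      simp only [weight, neg_inj]
      refine DiagramData.dualForm_root_dualPow_congr hω (a := 0) rfl ?_ _
      simpa using mul_right_cancel₀ (hz w) h
    · exact absurd h.symm h0
  · have h := (hmem 0).1 (by rw [eval_form_pair]; simp)
    exact absurd h.symm h0

lemma weight_of_hyperplane_eq_zero (hω : IsPrimitiveRoot ω D.order) (hz : ∀ v, z v ≠ 0)
    {a : Fin (∑ i, lam i)} {x : Label (∑ i, lam i) N D.order}
    (hx : ((form ω z x).hyperplane : Set (Fin (∑ i, lam i) → ℂ)) = {t | t a = 0}) :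
    weight D rep Λ₀ Λ lam x = -D.invPairing (rep (block lam a)) Λ₀ := by
  have hω0 : ω ≠ 0 := hω.ne_zero D.order_pos.ne'
  have hmem : ∀ t : Fin (∑ i, lam i) → ℂ, (form ω z x).eval t = 0 ↔ t a = 0 :=
    fun t => Set.ext_iff.1 hx t
  rcases x with c | ⟨c, w, l⟩ | ⟨⟨⟨c, d⟩, hcd⟩, l⟩
  · by_cases hac : c = a
    · rw [hac]; rfl
    · have h := (hmem (Pi.single c 1)).2 (by simp [Ne.symm hac])
      rw [eval_form_inl] at h
      simp at h
  · have h := (hmem 0).2 rfl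
    rw [eval_form_point] at h
    simp [hω0, hz] at h
  · have h := (hmem (Function.update (fun _ => 1) c (ω ^ (l : ℕ)))).1 (by
      have : d ≠ c := (ne_of_lt hcd).symm
      rw [eval_form_pair]; simp [this])
    rw [Function.update_apply] at h
    split_ifs at h
    · exact absurd h (pow_ne_zero _ hω0)
    · exact absurd h one_ne_zero

end Cyclotomic

theorem mainTheorem11 {𝔥 : Type*} [AddCommGroup 𝔥] [Module ℂ 𝔥] [FiniteDimensional ℂ 𝔥]
    {R r N : ℕ} (D : DiagramData 𝔥 R) (rep : Fin r → Fin R)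
    (hrep : ∀ x, ∃! i, D.perm.SameCycle (rep i) x)
    (ω : ℂ) (hω : IsPrimitiveRoot ω D.order)
    (z : Fin N → ℂ) (hz : ∀ v, z v ≠ 0)
    (hzz : ∀ v w, v ≠ w → ∀ k : ℕ, z v ≠ ω ^ k * z w)
    (Λ₀ : Module.Dual ℂ D.invariants) (Λ : Fin N → Module.Dual ℂ 𝔥) (lam : Fin r → ℕ) :
    (∀ (i j : Fin r) (k : ℕ),
      D.dualForm (D.root (rep i)) (D.dualPow k (D.root (rep j))) = 0 →
      ∀ (n : Fin (lam i)) (p : Fin (lam j)), Cyclotomic.idx lam i n ≠ Cyclotomic.idx lam j p →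
        Arrangement.RegularOn
          (Cyclotomic.form ω z : Cyclotomic.Label (∑ i, lam i) N D.order → AffForm (∑ i, lam i))
          (Cyclotomic.weightFunction D rep ω z Λ₀ Λ lam)
          {t | t (Cyclotomic.idx lam i n) = ω ^ k * t (Cyclotomic.idx lam j p)}) ∧
    (∀ (i : Fin r) (v : Fin N) (k : ℕ),
      D.dualForm (D.root (rep i)) (D.dualPow k (Λ v)) = 0 →
      ∀ n : Fin (lam i),
        Arrangement.RegularOn
          (Cyclotomic.form ω z : Cyclotomic.Label (∑ i, lam i) N D.order → AffForm (∑ i, lam i))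
          (Cyclotomic.weightFunction D rep ω z Λ₀ Λ lam)
          {t | t (Cyclotomic.idx lam i n) = ω ^ k * z v}) ∧
    (∀ i : Fin r, D.invPairing (rep i) Λ₀ = 0 →
      ∀ n : Fin (lam i),
        Arrangement.RegularOn
          (Cyclotomic.form ω z : Cyclotomic.Label (∑ i, lam i) N D.order → AffForm (∑ i, lam i))
          (Cyclotomic.weightFunction D rep ω z Λ₀ Λ lam)
          {t | t (Cyclotomic.idx lam i n) = 0}) ∧
    (∀ p : Fin (∑ i, lam i) → ℂ,
      (∀ x : Cyclotomic.Label (∑ i, lam i) N D.order,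
        Cyclotomic.weight D rep Λ₀ Λ lam x ≠ 0 → p ∉ (Cyclotomic.form ω z x).hyperplane) →
      Arrangement.RegularAt
        (Cyclotomic.form ω z : Cyclotomic.Label (∑ i, lam i) N D.order → AffForm (∑ i, lam i))
        (Cyclotomic.weightFunction D rep ω z Λ₀ Λ lam) p) := by
  have main := fun p => Cyclotomic.regularAt_weightFunction (Λ₀ := Λ₀) (Λ := Λ) (lam := lam)
    (rep := rep) (p := p) hω hz hzz
  refine ⟨fun i j k h n q hnq p hp hS => main p fun x hx hpx => hx ?_,
    fun i v k h n p hp hS => main p fun x hx hpx => hx ?_,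
    fun i h n p hp hS => main p fun x hx hpx => hx ?_, main⟩
  · rw [Cyclotomic.weight_of_hyperplane_eq_pair hω hz hnq k (hS x hpx), Cyclotomic.block_idx,
      Cyclotomic.block_idx, h]
  · rw [Cyclotomic.weight_of_hyperplane_eq_point hω hz hzz v k (hS x hpx), Cyclotomic.block_idx, h,
      neg_zero]
  · rw [Cyclotomic.weight_of_hyperplane_eq_zero hω hz (hS x hpx), Cyclotomic.block_idx, h, neg_zero]
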